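/- For a finite group $H$ of permutations of a finite non-empty set $V$ that is transitive on $V$, a subset $\mathcal F\subseteq H$ is intersecting if for all $f,g\in\mathcal F$ there is $v\in V$ with $f(v)=g(v)$, and the intersection density $\rho(H)$ is the maximum of $|\mathcal F|$ over intersecting $\mathcal F\subseteq H$, divided by $|H|/|V|$. For a finite vertex-transitive graph $X$, the intersection density array of $X$ is the increasing list of the distinct values $\rho(H)$ with $H\le\operatorname{Aut}(X)$ transitive on vertices; the weak intersection density array $\overline\rho(X)$ is the sub-list of those values that are equal to $\rho(H)$ for some $H\le\operatorname{Aut}(X)$ that is transitive on arcs. An $s$-arc of $X$ is an $(s+1)$-tuple of distinct vertices whose consecutive entries are adjacent; a group $H\le\operatorname{Aut}(X)$ is $s$-arc-regular if for any two $s$-arcs exactly one element of $H$ maps the first to the second, and arc-regular means $1$-arc-regular. A cubic arc-transitive graph $X$ is of type $\{1,2^1\}$ if $\operatorname{Aut}(X)$ is $2$-arc-regular, has a $1$-arc-regular subgroup, and the stabilizer in $\operatorname{Aut}(X)$ of an edge is isomorphic to $\mathbb Z_2^2$. **Theorem.** Let $p$ be an odd prime, $q=p^k$, and let $X$ be a finite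 cubic arc-transitive graph of type $\{1,2^1\}$ with $\operatorname{Aut}(X)=\mathrm{PGL}(2,q)$ (as abstract groups), such that the subgroup $\mathrm{PSL}(2,q)\le\mathrm{PGL}(2,q)$ is arc-regular on $X$. Then $$\overline\rho(X)=\begin{cases}[3^{k-1}] & \text{if } p=3 \text{ and } k \text{ is odd},\\ [3^{k/2-1}] & \text{if } p=3 \text{ and } k \text{ is even},\\ [1,2] & \text{if } q\equiv 1 \pmod 3 \text{ and } p=5,\\ [1,\tfrac43] & \text{if } q\equiv 1\pmod 3 \text{ and } p\ne 5,\\ [1] & \text{if } q\equiv 2\pmod 3 \text{ and } q\equiv\pm2\pmod 5,\\ [1,\tfrac43] & \text{if } q\equiv 2\pmod 3 \text{ and } q\equiv 0,\pm1\pmod 5.\end{cases}$$ -/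

import Mathlib

open scoped MatrixGroups Pointwise

namespace IntersectionDensity

/-- A set `F` of group elements acting on `V` is intersecting if any two of its members agree on
at least one point of `V`. -/
def IsIntersecting {G : Type*} (V : Type*) [SMul G V] (F : Set G) : Prop :=
  ∀ f ∈ F, ∀ g ∈ F, ∃ v : V, f • v = g • v

/-- The intersection density `ρ(G)` of a finite group `G` acting on a finite set `V`: the largest
size of an intersecting subset of `G`, divided by `|G| / |V|`. -/
noncomputable def density (G V : Type*) [Group G] [MulAction G V] : ℚ :=
  ((sSup {n : ℕ | ∃ F : Finset G, IsIntersecting V (F : Set G) ∧ F.card = n} : ℕ) : ℚ) /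
    ((Nat.card G : ℚ) / (Nat.card V : ℚ))

section Graph

variable {V : Type*} (X : SimpleGraph V)

/-- `a = (a₀, …, a_s)` is an `s`-arc of `X`: distinct vertices, consecutive ones adjacent. -/
def IsSArc (s : ℕ) (a : Fin (s + 1) → V) : Prop :=
  Function.Injective a ∧ ∀ i : Fin s, X.Adj (a i.castSucc) (a i.succ)

variable {X}

/-- The group `H` of automorphisms of `X` acts transitively on the `s`-arcs of `X`. -/
def IsSArcTransitive (s : ℕ) (H : Subgroup (X ≃g X)) : Prop :=
  ∀ a b : Fin (s + 1) → V, IsSArc X s a → IsSArc X s b → ∃ g ∈ H, ∀ i, g (a i) = b i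

/-- The group `H` of automorphisms of `X` acts regularly on the `s`-arcs of `X`. -/
def IsSArcRegular (s : ℕ) (H : Subgroup (X ≃g X)) : Prop :=
  ∀ a b : Fin (s + 1) → V, IsSArc X s a → IsSArc X s b → ∃! g, g ∈ H ∧ ∀ i, g (a i) = b i

variable (X)

/-- `X` is a cubic arc-transitive graph of type `{1, 2¹}`. (In the last field, the stabilizer of
the edge is the stabilizer of the two-element set `{u, v}` in the full automorphism group.) -/
structure IsCubicOfTypeOneTwo [X.LocallyFinite] : Prop where
  cubic : X.IsRegularOfDegree 3
  arcTransitive : IsSArcTransitive 1 (⊤ : Subgroup (X ≃g X))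
  twoArcRegular : IsSArcRegular 2 (⊤ : Subgroup (X ≃g X))
  exists_arcRegular : ∃ H : Subgroup (X ≃g X), IsSArcRegular 1 H
  edgeStabilizer : ∀ u v : V, X.Adj u v →
    IsKleinFour (MulAction.stabilizer (X ≃g X) ({u, v} : Set V))

instance instFiniteAut [Finite V] : Finite (X ≃g X) :=
  Finite.of_injective (fun g : X ≃g X => (g : V → V)) DFunLike.coe_injective

/-- The intersection density array `ρ(X)`: the intersection densities of the transitive groups of
automorphisms of `X`, each listed once, in increasing order. -/
noncomputable def densityArray [Finite V] : List ℚ :=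
  ((Set.toFinite {H : Subgroup (X ≃g X) | MulAction.IsPretransitive H V}).image
    (fun H : Subgroup (X ≃g X) => density H V)).toFinset.sort (· ≤ ·)

open Classical in
/-- The weak intersection density array of `X`: the sub-array of the intersection density array
of those values that are realized by arc-transitive groups of automorphisms of `X`. -/
noncomputable def weakDensityArray [Finite V] : List ℚ :=
  (densityArray X).filter
    (fun r => ∃ H : Subgroup (X ≃g X), IsSArcTransitive 1 H ∧ density H V = r)

end Graph

/-- `PSL(2, F)` as a subgroup of `PGL(2, F)`. -/
def pslSubgroup (F : Type*) [Field F] : Subgroup PGL(2, F) :=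
  (Matrix.ProjectiveSpecialLinearGroup.toPGL :
    Matrix.ProjectiveSpecialLinearGroup (Fin 2) F →* PGL(2, F)).range

end IntersectionDensity

/-!
The vertex stabilizers of `X` act faithfully on the three neighbors, since two neighbors and the
vertex form a `2`-arc. They are symmetric groups of degree three, and meet `PSL(2, F)` in groups
of order three. In `PGL(2, F)` all elements of order three are conjugate, and so are all
involutions outside `PSL(2, F)`; hence an element fixes a vertex exactly if its cube is trivial or
it is an involution outside `PSL(2, F)` (`exists_fixed_vertex_iff`). By counting arcs, an
arc-transitive group has index at most two, so it is `PGL(2, F)` or `PSL(2, F)`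
(`isSArcTransitive_iff`). The array therefore lists the densities of these two groups, and the
task is to find the largest sets in them whose quotients are all of the stated kind.

Assume first that the characteristic is not three. Lifted to determinant one, elements of `PSL(2,
F)` whose quotients have order three are vectors of the four-dimensional space of matrices with
the determinant form, at inner products `1` and `-1` up to the choice of lifts: equiangular lines.
With one of them moved to the identity, the others become vectors of the three-dimensional space
of trace zero matrices (`exists_vectors_of_pow_three`). There, Gram determinants of four vectors
vanish (`symmDetFour_traceZeroForm_eq_zero`) and those of three vectors are squares up to a
constant factor (`gram_three`). As the Gram matrices have integer entries, this restricts the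
characteristic and forces `-3` or `5` to be a square, whence the upper bounds for `PSL(2, F)`.
They are attained by matrices over the cube roots of unity if `-3` is a square, and inside an
icosahedral group if `5` is. In `PGL(2, F)` an element of the other coset is orthogonal to the
given ones; together with the Gram determinants this shows that no intersecting set is larger than
a vertex stabilizer (`card_le_six_of_vertexFixing`), so that the density is one.

In characteristic three the elements of order three are unipotent. The involution in a vertex
stabilizer inverts a unipotent element, so that `-1` is not a square (`not_isSquare_neg_one`).
Thus `q` is an odd power of three, and the case of an even power does not occur. Isotropic vectors
that are orthogonal are parallel, and the Gram determinant of three pairwise nonorthogonal ones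
would make `-1` a square; hence no intersecting set is larger than a Sylow subgroup in `PSL(2, F)`
(`card_le_card_field`), or its extension by an involution in `PGL(2, F)`.
-/

namespace IntersectionDensity

/-! ### Elements of `PGL(2, F)` as classes of matrices -/

section ProjectiveClasses

variable {F : Type*} [Field F]

theorem coe_mkOfDetNeZero (A : Matrix (Fin 2) (Fin 2) F) (hA : A.det ≠ 0) :
    (Matrix.GeneralLinearGroup.mkOfDetNeZero A hA : Matrix (Fin 2) (Fin 2) F) = A := rfl

/-- The element of `PGL(2, F)` represented by an invertible matrix. -/
noncomputable def proj (A : Matrix (Fin 2) (Fin 2) F) (hA : A.det ≠ 0) : PGL(2, F) :=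
  Matrix.ProjGenLinGroup.mk (Matrix.GeneralLinearGroup.mkOfDetNeZero A hA)

theorem exists_eq_proj (g : PGL(2, F)) : ∃ A hA, g = proj A hA := by
  induction g using Matrix.ProjGenLinGroup.induction_on with | mk g =>
  refine ⟨g.1, g.det.ne_zero, ?_⟩
  exact congrArg Matrix.ProjGenLinGroup.mk (Units.ext rfl)

theorem proj_eq_proj_iff {A C : Matrix (Fin 2) (Fin 2) F} {hA : A.det ≠ 0} {hC : C.det ≠ 0} :
    proj A hA = proj C hC ↔ ∃ u : F, u ≠ 0 ∧ C = u • A := by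
  unfold proj
  rw [Matrix.ProjGenLinGroup.mk_eq_mk_iff]
  constructor
  · rintro ⟨u, hu⟩
    refine ⟨u, u.ne_zero, ?_⟩
    have h := congrArg Units.val hu
    rw [Units.val_mul, coe_mkOfDetNeZero, coe_mkOfDetNeZero,
      Matrix.GeneralLinearGroup.coe_scalar] at h
    rw [← h]
    ext i j
    simp [mul_comm]
  · rintro ⟨u, hu, h⟩
    refine ⟨Units.mk0 u hu, Units.ext ?_⟩
    rw [Units.val_mul, coe_mkOfDetNeZero, coe_mkOfDetNeZero,
      Matrix.GeneralLinearGroup.coe_scalar, h]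
    ext i j
    simp [mul_comm]

theorem proj_mul {A C : Matrix (Fin 2) (Fin 2) F} (hA : A.det ≠ 0) (hC : C.det ≠ 0) :
    proj A hA * proj C hC = proj (A * C) (by rw [Matrix.det_mul]; exact mul_ne_zero hA hC) := by
  unfold proj
  rw [← map_mul]
  exact congrArg Matrix.ProjGenLinGroup.mk (Units.ext rfl)

theorem proj_one : proj (1 : Matrix (Fin 2) (Fin 2) F) (by simp) = 1 := by
  exact congrArg Matrix.ProjGenLinGroup.mk (Units.ext rfl)

theorem proj_eq_one_iff {A : Matrix (Fin 2) (Fin 2) F} {hA : A.det ≠ 0} :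
    proj A hA = 1 ↔ A 0 1 = 0 ∧ A 1 0 = 0 ∧ A 0 0 = A 1 1 := by
  rw [← proj_one, eq_comm, proj_eq_proj_iff]
  constructor
  · rintro ⟨u, -, rfl⟩
    simp
  · rintro ⟨h1, h2, h3⟩
    refine ⟨A 0 0, ?_, ?_⟩
    · rintro h0
      apply hA
      rw [Matrix.det_fin_two, ← h3, h0, h1]
      simp
    · ext i j
      fin_cases i <;> fin_cases j <;> simp [h1, h2, h3]

theorem det_adjugate_ne_zero {A : Matrix (Fin 2) (Fin 2) F} (hA : A.det ≠ 0) :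
    A.adjugate.det ≠ 0 := by
  rw [Matrix.det_adjugate]
  exact pow_ne_zero _ hA

theorem proj_inv {A : Matrix (Fin 2) (Fin 2) F} (hA : A.det ≠ 0) :
    (proj A hA)⁻¹ = proj A.adjugate (det_adjugate_ne_zero hA) := by
  rw [inv_eq_iff_mul_eq_one, proj_mul, proj_eq_one_iff]
  simp [Matrix.mul_adjugate]

theorem proj_mem_pslSubgroup_iff {A : Matrix (Fin 2) (Fin 2) F} {hA : A.det ≠ 0} :
    proj A hA ∈ pslSubgroup F ↔ IsSquare A.det := by
  have key : proj A hA ∈ pslSubgroup F ↔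
      ∃ S : Matrix.SpecialLinearGroup (Fin 2) F, proj S.1 (by simp [S.2]) = proj A hA := by
    unfold pslSubgroup
    rw [MonoidHom.mem_range]
    constructor
    · rintro ⟨S, hS⟩
      induction S using QuotientGroup.induction_on with | H S =>
      refine ⟨S, ?_⟩
      rw [← hS, Matrix.ProjectiveSpecialLinearGroup.toPGL_mk]
      exact congrArg Matrix.ProjGenLinGroup.mk (Units.ext rfl)
    · rintro ⟨S, hS⟩
      refine ⟨QuotientGroup.mk S, ?_⟩
      rw [← hS, Matrix.ProjectiveSpecialLinearGroup.toPGL_mk]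
      exact congrArg Matrix.ProjGenLinGroup.mk (Units.ext rfl)
  rw [key]
  constructor
  · rintro ⟨S, hS⟩
    obtain ⟨u, hu, h⟩ := proj_eq_proj_iff.1 hS
    refine ⟨u, ?_⟩
    rw [h, Matrix.det_smul, S.2]
    simp [sq]
  · rintro ⟨u, hu⟩
    have hu0 : u ≠ 0 := by rintro rfl; simp at hu; exact hA hu
    refine ⟨⟨u⁻¹ • A, ?_⟩, ?_⟩
    · rw [Matrix.det_smul, hu]
      simp
      field_simp
    · rw [proj_eq_proj_iff]
      exact ⟨u, hu0, by simp [smul_smul, hu0]⟩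

theorem exists_det_eq_one {g : PGL(2, F)} (hg : g ∈ pslSubgroup F) :
    ∃ (A : Matrix (Fin 2) (Fin 2) F) (hA : A.det ≠ 0), A.det = 1 ∧ g = proj A hA := by
  obtain ⟨A, hA, rfl⟩ := exists_eq_proj g
  obtain ⟨u, hu⟩ := proj_mem_pslSubgroup_iff.1 hg
  have hu0 : u ≠ 0 := by rintro rfl; simp at hu; exact hA hu
  have h1 : (u⁻¹ • A).det = 1 := by
    rw [Matrix.det_smul, hu]
    simp
    field_simp
  exact ⟨u⁻¹ • A, by simp [h1], h1, proj_eq_proj_iff.2 ⟨u⁻¹, inv_ne_zero hu0, rfl⟩⟩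

/-- By the Cayley–Hamilton theorem `A ^ 2 = tr A • A - det A • 1`, which is scalar for a
nonscalar `A` only if the trace vanishes. -/
theorem proj_sq_eq_one_iff {A : Matrix (Fin 2) (Fin 2) F} {hA : A.det ≠ 0} :
    proj A hA ^ 2 = 1 ↔ proj A hA = 1 ∨ A.trace = 0 := by
  rw [sq, proj_mul, proj_eq_one_iff, proj_eq_one_iff, Matrix.trace_fin_two]
  simp only [Matrix.mul_apply, Fin.sum_univ_two]
  grind

/-- By the Cayley–Hamilton theorem `A ^ 3` is a scalar matrix plus
`((tr A) ^ 2 - det A) • A`. -/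
theorem proj_pow_three_eq_one_iff {A : Matrix (Fin 2) (Fin 2) F} {hA : A.det ≠ 0} :
    proj A hA ^ 3 = 1 ↔ proj A hA = 1 ∨ A.trace ^ 2 = A.det := by
  rw [pow_succ, sq, proj_mul, proj_mul, proj_eq_one_iff, proj_eq_one_iff, Matrix.trace_fin_two,
    Matrix.det_fin_two]
  simp only [Matrix.mul_apply, Fin.sum_univ_two]
  have h01 : (A 0 0 * A 0 0 + A 0 1 * A 1 0) * A 0 1 + (A 0 0 * A 0 1 + A 0 1 * A 1 1) * A 1 1
      = ((A 0 0 + A 1 1) ^ 2 - (A 0 0 * A 1 1 - A 0 1 * A 1 0)) * A 0 1 := by ring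
  have h10 : (A 1 0 * A 0 0 + A 1 1 * A 1 0) * A 0 0 + (A 1 0 * A 0 1 + A 1 1 * A 1 1) * A 1 0
      = ((A 0 0 + A 1 1) ^ 2 - (A 0 0 * A 1 1 - A 0 1 * A 1 0)) * A 1 0 := by ring
  have h00 : ((A 0 0 * A 0 0 + A 0 1 * A 1 0) * A 0 0 + (A 0 0 * A 0 1 + A 0 1 * A 1 1) * A 1 0)
      - ((A 1 0 * A 0 0 + A 1 1 * A 1 0) * A 0 1 + (A 1 0 * A 0 1 + A 1 1 * A 1 1) * A 1 1)
      = ((A 0 0 + A 1 1) ^ 2 - (A 0 0 * A 1 1 - A 0 1 * A 1 0)) * (A 0 0 - A 1 1) := by ring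
  rw [h01, h10]
  constructor
  · rintro ⟨h1, h2, h3⟩
    rw [h3, sub_self] at h00
    by_contra! hne
    have hne2 := sub_ne_zero.2 hne.2
    exact hne.1 ((mul_eq_zero.1 h1).resolve_left hne2) ((mul_eq_zero.1 h2).resolve_left hne2)
      (sub_eq_zero.1 ((mul_eq_zero.1 h00.symm).resolve_left hne2))
  · rintro (⟨h1, h2, h3⟩ | h)
    · simp [h1, h2, h3]
    · rw [h, sub_self, zero_mul, zero_mul]
      rw [h, sub_self, zero_mul] at h00
      exact ⟨rfl, rfl, sub_eq_zero.1 h00⟩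

/-- The polar form of the determinant of `2 × 2` matrices, `tr (adj A * C)`. -/
def polar (A C : Matrix (Fin 2) (Fin 2) F) : F :=
  A 0 0 * C 1 1 + A 1 1 * C 0 0 - A 0 1 * C 1 0 - A 1 0 * C 0 1

theorem trace_adjugate_mul (A C : Matrix (Fin 2) (Fin 2) F) :
    (A.adjugate * C).trace = polar A C := by
  rw [Matrix.trace_fin_two, Matrix.adjugate_fin_two, polar]
  simp [Matrix.mul_apply, Fin.sum_univ_two]
  ring

theorem det_adjugate_mul (A C : Matrix (Fin 2) (Fin 2) F) :
    (A.adjugate * C).det = A.det * C.det := by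
  rw [Matrix.det_mul, Matrix.det_adjugate]
  simp

variable (F) in
/-- The elements of `PGL(2, F)` whose cube is trivial, together with the involutions outside
`PSL(2, F)`. For the graphs considered here these are the elements that fix a vertex, see
`exists_fixed_vertex_iff`. -/
def vertexFixing : Set PGL(2, F) := {g | g ^ 3 = 1 ∨ (g ^ 2 = 1 ∧ g ∉ pslSubgroup F)}

theorem inv_mul_mem_vertexFixing_iff {A C : Matrix (Fin 2) (Fin 2) F} {hA : A.det ≠ 0}
    {hC : C.det ≠ 0} :
    (proj A hA)⁻¹ * proj C hC ∈ vertexFixing F ↔ proj A hA = proj C hC ∨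
      polar A C ^ 2 = A.det * C.det ∨ (polar A C = 0 ∧ ¬ IsSquare (A.det * C.det)) := by
  rw [vertexFixing, Set.mem_ofPred_eq, ← inv_mul_eq_one (a := proj A hA)]
  rw [proj_inv, proj_mul, proj_sq_eq_one_iff, proj_pow_three_eq_one_iff, proj_mem_pslSubgroup_iff,
    trace_adjugate_mul]
  simp only [det_adjugate_mul]
  have : proj (A.adjugate * C) (by rw [det_adjugate_mul]; exact mul_ne_zero hA hC) = 1 →
      IsSquare (A.det * C.det) := by
    intro h
    rw [← det_adjugate_mul, ← proj_mem_pslSubgroup_iff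
      (hA := by rw [det_adjugate_mul]; exact mul_ne_zero hA hC), h]
    exact one_mem _
  tauto

theorem pow_three_inv_mul_iff {A C : Matrix (Fin 2) (Fin 2) F} {hA : A.det ≠ 0}
    {hC : C.det ≠ 0} :
    ((proj A hA)⁻¹ * proj C hC) ^ 3 = 1 ↔ proj A hA = proj C hC ∨
      polar A C ^ 2 = A.det * C.det := by
  rw [← inv_mul_eq_one (a := proj A hA), proj_inv, proj_mul, proj_pow_three_eq_one_iff,
    trace_adjugate_mul]
  simp only [det_adjugate_mul]

theorem mem_pslSubgroup_of_pow_three {g : PGL(2, F)} (hg : g ^ 3 = 1) : g ∈ pslSubgroup F := by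
  obtain ⟨A, hA, rfl⟩ := exists_eq_proj g
  rcases proj_pow_three_eq_one_iff.1 hg with h | h
  · rw [h]; exact one_mem _
  · exact proj_mem_pslSubgroup_iff.2 ⟨A.trace, by rw [← h, sq]⟩

theorem pow_three_of_mem_vertexFixing {g : PGL(2, F)} (hg : g ∈ vertexFixing F)
    (h : g ∈ pslSubgroup F) : g ^ 3 = 1 :=
  hg.resolve_right fun h' => h'.2 h

end ProjectiveClasses

/-! ### Conjugacy classes -/

section Conjugacy

variable {F : Type*} [Field F]

/-- A non-scalar `2 × 2` matrix is similar to the companion matrix of its characteristic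
polynomial. -/
theorem exists_mul_eq_mul_companion {A : Matrix (Fin 2) (Fin 2) F}
    (h : ¬ (A 0 1 = 0 ∧ A 1 0 = 0 ∧ A 0 0 = A 1 1)) :
    ∃ P : Matrix (Fin 2) (Fin 2) F, P.det ≠ 0 ∧ A * P = P * !![0, -A.det; 1, A.trace] := by
  -- The columns of `P` are `v` and `A v` for a vector `v` that is not an eigenvector of `A`.
  have main : ∀ x y : F, x * (A 1 0 * x + A 1 1 * y) - (A 0 0 * x + A 0 1 * y) * y ≠ 0 →
      ∃ P : Matrix (Fin 2) (Fin 2) F, P.det ≠ 0 ∧ A * P = P * !![0, -A.det; 1, A.trace] := by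
    intro x y hxy
    refine ⟨!![x, A 0 0 * x + A 0 1 * y; y, A 1 0 * x + A 1 1 * y], ?_, ?_⟩
    · rw [Matrix.det_fin_two]
      simpa using hxy
    · rw [Matrix.det_fin_two, Matrix.trace_fin_two]
      ext i j
      fin_cases i <;> fin_cases j <;> simp [Matrix.mul_apply, Fin.sum_univ_two] <;> ring
  by_cases h1 : A 1 0 = 0
  · by_cases h2 : A 0 1 = 0
    · apply main 1 1
      simp only [h1, h2]
      intro h3
      apply h
      refine ⟨h2, h1, ?_⟩
      linear_combination -h3
    · apply main 0 1
      simpa using h2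
  · apply main 1 0
    simpa using h1

/-- Nonscalar matrices with the same characteristic polynomial are similar. -/
theorem isConj_proj {A C : Matrix (Fin 2) (Fin 2) F} {hA : A.det ≠ 0} {hC : C.det ≠ 0}
    (hA1 : proj A hA ≠ 1) (hC1 : proj C hC ≠ 1) (hdet : A.det = C.det)
    (htr : A.trace = C.trace) : IsConj (proj A hA) (proj C hC) := by
  rw [Ne, proj_eq_one_iff] at hA1 hC1
  obtain ⟨P, hP, hP'⟩ := exists_mul_eq_mul_companion hA1
  obtain ⟨R, hR, hR'⟩ := exists_mul_eq_mul_companion hC1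
  have hK : (!![0, -A.det; 1, A.trace] : Matrix (Fin 2) (Fin 2) F).det ≠ 0 := by
    rw [Matrix.det_fin_two]; simpa using hA
  rw [← hdet, ← htr] at hR'
  have h1 : IsConj (proj _ hK) (proj A hA) := by
    rw [isConj_iff]
    refine ⟨proj P hP, ?_⟩
    rw [mul_inv_eq_iff_eq_mul, proj_mul, proj_mul, proj_eq_proj_iff]
    exact ⟨1, one_ne_zero, by rw [one_smul, hP']⟩
  have h2 : IsConj (proj _ hK) (proj C hC) := by
    rw [isConj_iff]
    refine ⟨proj R hR, ?_⟩
    rw [mul_inv_eq_iff_eq_mul, proj_mul, proj_mul, proj_eq_proj_iff]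
    exact ⟨1, one_ne_zero, by rw [one_smul, hR']⟩
  exact h1.symm.trans h2

/-- An element of order three is represented by `A` with `(tr A) ^ 2 = det A`, hence by
`A / tr A`. -/
theorem exists_det_eq_one_trace_eq_one {g : PGL(2, F)} (hg : g ^ 3 = 1) (hg1 : g ≠ 1) :
    ∃ (A : Matrix (Fin 2) (Fin 2) F) (hA : A.det ≠ 0),
      A.det = 1 ∧ A.trace = 1 ∧ g = proj A hA := by
  obtain ⟨A, hA, rfl⟩ := exists_eq_proj g
  have ht := (proj_pow_three_eq_one_iff.1 hg).resolve_left hg1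
  have ht0 : A.trace ≠ 0 := by
    intro h0; rw [h0] at ht; apply hA; rw [← ht]; simp
  have hd : (A.trace⁻¹ • A).det = 1 := by
    rw [Matrix.det_smul, ← ht]; simp; field_simp
  refine ⟨A.trace⁻¹ • A, by simp [hd], hd, ?_, ?_⟩
  · rw [Matrix.trace_smul]; simp [ht0]
  · exact proj_eq_proj_iff.2 ⟨_, inv_ne_zero ht0, rfl⟩

/-- All elements of order three of `PGL(2, F)` are conjugate. -/
theorem isConj_of_pow_three {g h : PGL(2, F)} (hg : g ^ 3 = 1) (hg1 : g ≠ 1) (hh : h ^ 3 = 1)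
    (hh1 : h ≠ 1) : IsConj g h := by
  obtain ⟨A, hA, hA1, hA2, rfl⟩ := exists_det_eq_one_trace_eq_one hg hg1
  obtain ⟨C, hC, hC1, hC2, rfl⟩ := exists_det_eq_one_trace_eq_one hh hh1
  exact isConj_proj hg1 hh1 (hA1.trans hC1.symm) (hA2.trans hC2.symm)

/-- In a finite field the product of two nonsquares is a square. -/
theorem isSquare_mul_of_not_isSquare [Finite F] {a b : F} (ha : ¬ IsSquare a)
    (hb : ¬ IsSquare b) : IsSquare (a * b) := by
  classical
  have := Fintype.ofFinite F
  have ha0 : a ≠ 0 := by rintro rfl; exact ha (IsSquare.zero)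
  have hb0 : b ≠ 0 := by rintro rfl; exact hb (IsSquare.zero)
  rw [← quadraticChar_one_iff_isSquare (mul_ne_zero ha0 hb0), map_mul,
    quadraticChar_neg_one_iff_not_isSquare.2 ha, quadraticChar_neg_one_iff_not_isSquare.2 hb]
  norm_num

/-- All involutions of `PGL(2, F)` outside `PSL(2, F)` are conjugate. -/
theorem isConj_of_sq [Finite F] {g h : PGL(2, F)} (hg : g ^ 2 = 1)
    (hg1 : g ∉ pslSubgroup F) (hh : h ^ 2 = 1) (hh1 : h ∉ pslSubgroup F) : IsConj g h := by
  have hg' : g ≠ 1 := by rintro rfl; exact hg1 (one_mem _)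
  have hh' : h ≠ 1 := by rintro rfl; exact hh1 (one_mem _)
  obtain ⟨A, hA, rfl⟩ := exists_eq_proj g
  obtain ⟨C, hC, rfl⟩ := exists_eq_proj h
  have hAt := (proj_sq_eq_one_iff.1 hg).resolve_left hg'
  have hCt := (proj_sq_eq_one_iff.1 hh).resolve_left hh'
  obtain ⟨u, hu⟩ := isSquare_mul_of_not_isSquare (mt proj_mem_pslSubgroup_iff.2 hg1)
    (mt proj_mem_pslSubgroup_iff.2 hh1)
  have hu0 : u ≠ 0 := by rintro rfl; simp at hu; tauto
  have hd : ((u / A.det) • A).det = C.det := by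
    rw [Matrix.det_smul]
    simp
    field_simp
    linear_combination -hu
  have hne : ((u / A.det) • A).det ≠ 0 := by rwa [hd]
  have he : proj A hA = proj _ hne := proj_eq_proj_iff.2 ⟨_, div_ne_zero hu0 hA, rfl⟩
  rw [he] at hg' ⊢
  refine isConj_proj hg' hh' hd ?_
  rw [Matrix.trace_smul, hAt, hCt, smul_zero]

end Conjugacy

/-! ### Gram determinants of trace zero matrices -/

section Gram

variable {F : Type*} [Field F]

/-- The polar form of the determinant on trace zero matrices, where `v` stands for the matrix
`!![v 0, v 1; v 2, -v 0]`. -/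
def traceZeroForm (v w : Fin 3 → F) : F := -(2 * v 0 * w 0) - v 1 * w 2 - v 2 * w 1

theorem traceZeroForm_comm (v w : Fin 3 → F) : traceZeroForm v w = traceZeroForm w v := by
  simp only [traceZeroForm]; ring

/-- The Gram determinant of three vectors, with the discriminant `2` of the form. -/
theorem gram_three (u v w : Fin 3 → F) :
    2 * (Matrix.of ![u, v, w]).det ^ 2 =
      traceZeroForm u u * traceZeroForm v v * traceZeroForm w w
      + 2 * traceZeroForm u v * traceZeroForm v w * traceZeroForm u w
      - traceZeroForm u u * traceZeroForm v w ^ 2 - traceZeroForm v v * traceZeroForm u w ^ 2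
      - traceZeroForm w w * traceZeroForm u v ^ 2 := by
  rw [Matrix.det_fin_three]
  simp [traceZeroForm]
  ring

/-- A vector orthogonal to a basis vanishes, as the form is nondegenerate. -/
theorem eq_zero_of_traceZeroForm_eq_zero (h2 : (2 : F) ≠ 0) {u v w x : Fin 3 → F}
    (h : (Matrix.of ![u, v, w]).det ≠ 0) (hu : traceZeroForm u x = 0)
    (hv : traceZeroForm v x = 0) (hw : traceZeroForm w x = 0) : x = 0 := by
  have key : (Matrix.of ![u, v, w]).mulVec ![2 * x 0, x 2, x 1] = 0 := by
    simp only [traceZeroForm] at hu hv hw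
    ext i
    fin_cases i <;> simp [Matrix.mulVec, dotProduct, Fin.sum_univ_three]
    · linear_combination -hu
    · linear_combination -hv
    · linear_combination -hw
  have h0 := Matrix.eq_zero_of_mulVec_eq_zero h key
  have a0 := congrFun h0 0
  have a1 := congrFun h0 1
  have a2 := congrFun h0 2
  simp [h2] at a0 a1 a2
  ext i
  fin_cases i <;> simp [a0, a1, a2]

/-- The determinant of the symmetric `4 × 4` matrix with constant diagonal `d` and entries
`a, b, c, e, f, g` above the diagonal, row by row. -/
def symmDetFour {R : Type*} [CommRing R] (d a b c e f g : R) : R :=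
  d ^ 4 - d ^ 2 * (a ^ 2 + b ^ 2 + c ^ 2 + e ^ 2 + f ^ 2 + g ^ 2)
    + 2 * d * (a * b * e + a * c * f + b * c * g + e * f * g)
    + (a * g) ^ 2 + (b * f) ^ 2 + (c * e) ^ 2
    - 2 * (a * g * (b * f) + a * g * (c * e) + b * f * (c * e))

/-- Four vectors of a three-dimensional space have vanishing Gram determinant. -/
theorem symmDetFour_traceZeroForm_eq_zero (v : Fin 4 → Fin 3 → F) (d : F)
    (hd : ∀ i, traceZeroForm (v i) (v i) = d) :
    symmDetFour d (traceZeroForm (v 0) (v 1)) (traceZeroForm (v 0) (v 2))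
      (traceZeroForm (v 0) (v 3)) (traceZeroForm (v 1) (v 2)) (traceZeroForm (v 1) (v 3))
      (traceZeroForm (v 2) (v 3)) = 0 := by
  have hdep : ¬ LinearIndependent F v := by
    intro h
    have := h.fintype_card_le_finrank
    simp at this
  obtain ⟨c, hc, i, hi⟩ := Fintype.not_linearIndependent_iff.1 hdep
  have hG : (Matrix.of fun i j => traceZeroForm (v i) (v j)).det = 0 := by
    rw [← Matrix.exists_mulVec_eq_zero_iff]
    refine ⟨c, fun h => hi (by rw [h]; rfl), ?_⟩
    have h0 := congrFun hc 0
    have h1 := congrFun hc 1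
    have h2 := congrFun hc 2
    simp [Fin.sum_univ_four] at h0 h1 h2
    ext j
    simp only [Matrix.mulVec, dotProduct, Fin.sum_univ_four, Matrix.of_apply, traceZeroForm,
      Pi.zero_apply]
    linear_combination (-2 * v j 0) * h0 - v j 2 * h1 - v j 1 * h2
  rw [← hG, Matrix.det_succ_row_zero]
  simp only [Fin.sum_univ_four, Matrix.det_fin_three]
  simp [Fin.succAbove, hd, symmDetFour, traceZeroForm_comm (v 1) (v 0),
    traceZeroForm_comm (v 2) (v 0), traceZeroForm_comm (v 3) (v 0), traceZeroForm_comm (v 2) (v 1),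
    traceZeroForm_comm (v 3) (v 1), traceZeroForm_comm (v 3) (v 2)]
  ring

theorem symmDetFour_mul {R : Type*} [CommRing R] (t d a b c e f g : R) :
    symmDetFour (t * d) (t * a) (t * b) (t * c) (t * e) (t * f) (t * g) =
      t ^ 4 * symmDetFour d a b c e f g := by
  simp only [symmDetFour]; ring

theorem symmDetFour_intCast (d a b c e f g : ℤ) :
    symmDetFour (d : F) a b c e f g = ((symmDetFour d a b c e f g : ℤ) : F) := by
  simp [symmDetFour]

end Gram

/-! ### Sign patterns of Gram matrices -/

section PSL

variable {F : Type*} [Field F]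

/-- Half of the inner product of two vectors `2 A - 1` and `2 C - 1`, where `A` and `C` have
determinant and trace one and `polar A C` is `1` or `-1`. -/
def orderThreeEntry (e : Bool) : ℤ := if e then 1 else -3

theorem symmDetFour_orderThreeEntry_dvd : ∀ a b c e f g : Bool,
    symmDetFour 3 (orderThreeEntry a) (orderThreeEntry b) (orderThreeEntry c) (orderThreeEntry e)
      (orderThreeEntry f) (orderThreeEntry g) ∣ 2 ^ 4 * 3 ^ 4 * 5 := by
  decide +kernel

/-- Whether the Gram determinant of four vectors, of inner products `2 * 3` on the diagonal and
`2 * orderThreeEntry` elsewhere, vanishes in characteristic five. -/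
def vanishesModFive (a b c e f g : Bool) : Bool :=
  symmDetFour 3 (orderThreeEntry a) (orderThreeEntry b) (orderThreeEntry c) (orderThreeEntry e)
      (orderThreeEntry f) (orderThreeEntry g) % 5 == 0

set_option synthInstance.maxHeartbeats 400000 in
set_option synthInstance.maxSize 2000 in
/-- In characteristic five there are no six vectors all of whose `4 × 4` Gram determinants vanish.
The quantifiers over the entries are grouped by the vector they add, so that the search is cut
short early. -/
theorem not_vanishesModFive_of_six : ∀ a b c e f g : Bool, vanishesModFive a b c e f g →
    ∀ h i j k : Bool, vanishesModFive a b h e i j → vanishesModFive a c h f i k →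
    vanishesModFive b c h g j k → vanishesModFive e f i g j k →
    ∀ l m n o p : Bool, vanishesModFive a b l e m n → vanishesModFive a c l f m o →
    vanishesModFive b c l g n o → vanishesModFive e f m g n o →
    vanishesModFive a h l i m p → vanishesModFive b h l j n p → ¬ vanishesModFive c h l k o p := by
  decide +kernel

end PSL

/-! ### Intersecting sets in `PSL(2, F)` -/

section OrderThreeBounds

variable {F : Type*} [Field F]

theorem exists_injective_fin_mem {α : Type*} {s : Finset α} {n : ℕ} (h : n ≤ s.card) :
    ∃ f : Fin n → α, Function.Injective f ∧ ∀ i, f i ∈ s :=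
  ⟨fun i => s.equivFin.symm (Fin.castLE h i),
    fun i j hij => by simpa using hij, fun i => Subtype.coe_prop _⟩

/-- Let `s` be a set of elements of `PGL(2, F)` whose quotients have order dividing three. Writing
the elements as `(1 + T) / 2` with `T` of trace zero, after translating one of them to the
identity, gives vectors with few possible inner products. -/
theorem exists_vectors_of_pow_three {s : Finset PGL(2, F)} (h2 : (2 : F) ≠ 0)
    (hs : ∀ f ∈ s, ∀ g ∈ s, (f⁻¹ * g) ^ 3 = 1) {n : ℕ} (hn : n + 1 ≤ s.card) :
    ∃ v : Fin n → Fin 3 → F, Function.Injective v ∧ (∀ i, v i ≠ 0) ∧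
      (∀ i, traceZeroForm (v i) (v i) = 2 * 3) ∧
      ∀ i j, i ≠ j → ∃ e : Bool, traceZeroForm (v i) (v j) = 2 * (orderThreeEntry e : F) := by
  obtain ⟨x, hx, hxs⟩ := exists_injective_fin_mem hn
  have hne : ∀ i : Fin n, (x 0)⁻¹ * x i.succ ≠ 1 := fun i => by
    rw [Ne, inv_mul_eq_one]
    exact fun h => Fin.succ_ne_zero i (hx h).symm
  have hA : ∀ i : Fin n, ∃ (A : Matrix (Fin 2) (Fin 2) F) (hA : A.det ≠ 0),
      A.det = 1 ∧ A.trace = 1 ∧ (x 0)⁻¹ * x i.succ = proj A hA := fun i =>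
    exists_det_eq_one_trace_eq_one (hs _ (hxs _) _ (hxs _)) (hne i)
  choose A hA hdet htr hAx using hA
  refine ⟨fun i => ![2 * A i 0 0 - 1, 2 * A i 0 1, 2 * A i 1 0], fun i j hij => ?_,
    fun i h0 => ?_, fun i => ?_, fun i j hij => ?_⟩
  · have h0 := congrFun hij 0
    have h1 := congrFun hij 1
    have h2' := congrFun hij 2
    simp [h2] at h0 h1 h2'
    have ti := htr i
    have tj := htr j
    rw [Matrix.trace_fin_two] at ti tj
    have hij' : A j = A i := by
      ext k l
      fin_cases k <;> fin_cases l <;> simp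
      · exact h0.symm
      · exact h1.symm
      · exact h2'.symm
      · linear_combination tj - ti + h0
    refine Fin.succ_injective _ (hx (mul_left_cancel (a := (x 0)⁻¹) ?_))
    rw [hAx, hAx, proj_eq_proj_iff]
    exact ⟨1, one_ne_zero, by rw [one_smul, hij']⟩
  · apply hne i
    have h0' := congrFun h0 0
    have h1' := congrFun h0 1
    have h2' := congrFun h0 2
    simp [h2] at h0' h1' h2'
    have ti := htr i
    rw [Matrix.trace_fin_two] at ti
    rw [hAx, proj_eq_one_iff]
    exact ⟨h1', h2', by linear_combination h0' - ti⟩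
  · have h1 := hdet i
    have h2 := htr i
    rw [Matrix.det_fin_two] at h1
    rw [Matrix.trace_fin_two] at h2
    simp only [traceZeroForm, Matrix.cons_val]
    rw [← eq_sub_iff_add_eq'] at h2
    rw [h2] at h1
    linear_combination 8 * h1
  · have hp : polar (A i) (A j) ^ 2 = 1 := by
      have h : ((proj (A i) (hA i))⁻¹ * proj (A j) (hA j)) ^ 3 = 1 := by
        rw [← hAx, ← hAx]
        simpa [mul_assoc] using hs _ (hxs i.succ) _ (hxs j.succ)
      rw [pow_three_inv_mul_iff, hdet, hdet, mul_one] at h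
      refine h.resolve_left fun h' => hij ?_
      rw [← hAx, ← hAx] at h'
      exact Fin.succ_injective _ (hx (mul_left_cancel h'))
    have h1 := htr i
    have h2 := htr j
    rw [Matrix.trace_fin_two] at h1 h2
    rw [← eq_sub_iff_add_eq'] at h1 h2
    have hQ : traceZeroForm ![2 * A i 0 0 - 1, 2 * A i 0 1, 2 * A i 1 0]
        ![2 * A j 0 0 - 1, 2 * A j 0 1, 2 * A j 1 0] = 4 * polar (A i) (A j) - 2 := by
      simp only [traceZeroForm, Matrix.cons_val, polar, h1, h2]
      ring
    rcases sq_eq_one_iff.1 hp with h | h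
    · exact ⟨true, by rw [hQ, h]; norm_num [orderThreeEntry]⟩
    · exact ⟨false, by rw [hQ, h]; norm_num [orderThreeEntry]⟩

theorem symmDetFour_eq_zero_of_entries (h2 : (2 : F) ≠ 0) {v : Fin 4 → Fin 3 → F} {d : ℤ}
    (hd : ∀ i, traceZeroForm (v i) (v i) = 2 * d) {a b c e f g : ℤ}
    (ha : traceZeroForm (v 0) (v 1) = 2 * a) (hb : traceZeroForm (v 0) (v 2) = 2 * b)
    (hc : traceZeroForm (v 0) (v 3) = 2 * c) (he : traceZeroForm (v 1) (v 2) = 2 * e)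
    (hf : traceZeroForm (v 1) (v 3) = 2 * f) (hg : traceZeroForm (v 2) (v 3) = 2 * g) :
    ((symmDetFour d a b c e f g : ℤ) : F) = 0 := by
  have h := symmDetFour_traceZeroForm_eq_zero v (2 * d) hd
  rw [ha, hb, hc, he, hf, hg, symmDetFour_mul, symmDetFour_intCast] at h
  exact (mul_eq_zero.1 h).resolve_left (pow_ne_zero _ h2)

/-- Five elements would give four vectors in three-dimensional space, and the possible Gram
determinants have no prime divisors except two, three and five. -/
theorem card_le_four_of_pow_three {s : Finset PGL(2, F)} (h2 : (2 : F) ≠ 0) (h3 : (3 : F) ≠ 0)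
    (h5 : (5 : F) ≠ 0) (hs : ∀ f ∈ s, ∀ g ∈ s, (f⁻¹ * g) ^ 3 = 1) : s.card ≤ 4 := by
  by_contra! hcard
  obtain ⟨v, -, -, hv, hv'⟩ := exists_vectors_of_pow_three h2 (n := 4) hs hcard
  choose e he using hv'
  have h := symmDetFour_eq_zero_of_entries h2 (d := 3) (by simpa using hv)
    (he 0 1 (by decide)) (he 0 2 (by decide)) (he 0 3 (by decide)) (he 1 2 (by decide))
    (he 1 3 (by decide)) (he 2 3 (by decide))
  obtain ⟨m, hm⟩ := symmDetFour_orderThreeEntry_dvd (e 0 1 (by decide)) (e 0 2 (by decide))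
    (e 0 3 (by decide)) (e 1 2 (by decide)) (e 1 3 (by decide)) (e 2 3 (by decide))
  have h0 : ((2 ^ 4 * 3 ^ 4 * 5 : ℤ) : F) = 0 := by rw [hm, Int.cast_mul, h, zero_mul]
  push_cast at h0
  exact mul_ne_zero (mul_ne_zero (pow_ne_zero 4 h2) (pow_ne_zero 4 h3)) h5
    (by linear_combination h0)

theorem charP_five (h5 : (5 : F) = 0) : CharP F 5 :=
  (CharP.charP_iff_prime_eq_zero Nat.prime_five).2 (by exact_mod_cast h5)

theorem card_le_six_of_pow_three {s : Finset PGL(2, F)} (h2 : (2 : F) ≠ 0) (h3 : (3 : F) ≠ 0)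
    (hs : ∀ f ∈ s, ∀ g ∈ s, (f⁻¹ * g) ^ 3 = 1) : s.card ≤ 6 := by
  by_cases h5 : (5 : F) = 0
  swap
  · exact (card_le_four_of_pow_three h2 h3 h5 hs).trans (by norm_num)
  by_contra! hcard
  obtain ⟨v, -, -, hv, hv'⟩ := exists_vectors_of_pow_three h2 (n := 6) hs hcard
  choose e he using hv'
  have := charP_five h5
  have key : ∀ i j k l : Fin 6, ∀ (hij : i < j) (hjk : j < k) (hkl : k < l),
      vanishesModFive (e i j hij.ne) (e i k (hij.trans hjk).ne)
        (e i l (hij.trans (hjk.trans hkl)).ne) (e j k hjk.ne) (e j l (hjk.trans hkl).ne)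
        (e k l hkl.ne) = true := by
    intro i j k l hij hjk hkl
    have h := symmDetFour_eq_zero_of_entries h2 (v := ![v i, v j, v k, v l]) (d := 3)
      (by intro m; fin_cases m <;> simpa using hv _)
      (he i j hij.ne) (he i k (hij.trans hjk).ne)
      (he i l (hij.trans (hjk.trans hkl)).ne) (he j k hjk.ne) (he j l (hjk.trans hkl).ne)
      (he k l hkl.ne)
    rw [CharP.intCast_eq_zero_iff F 5] at h
    unfold vanishesModFive
    rw [beq_iff_eq]
    exact Int.emod_eq_zero_of_dvd h
  exact not_vanishesModFive_of_six _ _ _ _ _ _ (key 0 1 2 3 (by decide) (by decide) (by decide))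
    _ _ _ _ (key 0 1 2 4 (by decide) (by decide) (by decide))
    (key 0 1 3 4 (by decide) (by decide) (by decide))
    (key 0 2 3 4 (by decide) (by decide) (by decide))
    (key 1 2 3 4 (by decide) (by decide) (by decide))
    _ _ _ _ _ (key 0 1 2 5 (by decide) (by decide) (by decide))
    (key 0 1 3 5 (by decide) (by decide) (by decide))
    (key 0 2 3 5 (by decide) (by decide) (by decide))
    (key 1 2 3 5 (by decide) (by decide) (by decide))
    (key 0 1 4 5 (by decide) (by decide) (by decide))
    (key 0 2 4 5 (by decide) (by decide) (by decide))
    (key 0 3 4 5 (by decide) (by decide) (by decide))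

/-- The Gram determinant of three of the vectors is a square up to a factor `2`, so that `-3` or
`5` has to be a square. -/
theorem isSquare_of_three_entries (h2 : (2 : F) ≠ 0) (h3 : (3 : F) ≠ 0) {u v w : Fin 3 → F}
    (hu : traceZeroForm u u = 2 * 3) (hv : traceZeroForm v v = 2 * 3)
    (hw : traceZeroForm w w = 2 * 3) {a b c : Bool}
    (ha : traceZeroForm u v = 2 * (orderThreeEntry a : F))
    (hb : traceZeroForm u w = 2 * (orderThreeEntry b : F))
    (hc : traceZeroForm v w = 2 * (orderThreeEntry c : F)) :
    IsSquare (-3 : F) ∨ (a = true ∧ b = true ∧ c = true ∧ IsSquare (5 : F)) := by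
  have h := gram_three u v w
  rw [hu, hv, hw, ha, hb, hc] at h
  set m := (Matrix.of ![u, v, w]).det
  have h4 : (4 : F) ≠ 0 := by
    have := mul_ne_zero h2 h2; norm_num at this; exact this
  have h12 : (12 : F) ≠ 0 := by
    have := mul_ne_zero h4 h3; norm_num at this; exact this
  cases a <;> cases b <;> cases c <;> simp [orderThreeEntry] at h ⊢
  case true.true.true =>
    right
    refine ⟨m / 4, ?_⟩
    field_simp
    exact mul_left_cancel₀ h2 (by linear_combination -h)
  case false.false.false =>
    refine ⟨m / 12, ?_⟩
    field_simp
    exact mul_left_cancel₀ h2 (by linear_combination -h)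
  all_goals
    refine ⟨m / 4, ?_⟩
    field_simp
    exact mul_left_cancel₀ h2 (by linear_combination -h)

/-- If `-3` is not a square, all inner products equal `2`, and the Gram determinant of four vectors
does not vanish. -/
theorem card_le_four_of_not_isSquare {s : Finset PGL(2, F)} (h2 : (2 : F) ≠ 0) (h3 : (3 : F) ≠ 0)
    (hsq : ¬ IsSquare (-3 : F)) (hs : ∀ f ∈ s, ∀ g ∈ s, (f⁻¹ * g) ^ 3 = 1) : s.card ≤ 4 := by
  by_contra! hcard
  obtain ⟨v, -, -, hv, hv'⟩ := exists_vectors_of_pow_three h2 (n := 4) hs hcard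
  choose e he using hv'
  have key : ∀ i j k : Fin 4, ∀ (hij : i ≠ j) (hik : i ≠ k) (hjk : j ≠ k),
      e i j hij = true ∧ e i k hik = true ∧ e j k hjk = true := fun i j k hij hik hjk =>
    have h := (isSquare_of_three_entries h2 h3 (hv i) (hv j) (hv k) (he i j hij) (he i k hik)
      (he j k hjk)).resolve_left hsq
    ⟨h.1, h.2.1, h.2.2.1⟩
  have h := symmDetFour_eq_zero_of_entries h2 (d := 3) (by simpa using hv)
    (he 0 1 (by decide)) (he 0 2 (by decide)) (he 0 3 (by decide)) (he 1 2 (by decide))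
    (he 1 3 (by decide)) (he 2 3 (by decide))
  obtain ⟨h01, h02, h12⟩ := key 0 1 2 (by decide) (by decide) (by decide)
  obtain ⟨-, h03, h13⟩ := key 0 1 3 (by decide) (by decide) (by decide)
  obtain ⟨-, -, h23⟩ := key 0 2 3 (by decide) (by decide) (by decide)
  rw [h01, h02, h03, h12, h13, h23] at h
  have h' : symmDetFour 3 (orderThreeEntry true) (orderThreeEntry true) (orderThreeEntry true)
      (orderThreeEntry true) (orderThreeEntry true) (orderThreeEntry true) = 2 ^ 4 * 3 := by
    decide
  rw [h'] at h
  push_cast at h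
  exact mul_ne_zero (pow_ne_zero 4 h2) h3 (by linear_combination h)

theorem card_le_three_of_pow_three {s : Finset PGL(2, F)} (h2 : (2 : F) ≠ 0) (h3 : (3 : F) ≠ 0)
    (hsq : ¬ IsSquare (-3 : F)) (hsq5 : ¬ IsSquare (5 : F))
    (hs : ∀ f ∈ s, ∀ g ∈ s, (f⁻¹ * g) ^ 3 = 1) : s.card ≤ 3 := by
  by_contra! hcard
  obtain ⟨v, -, -, hv, hv'⟩ := exists_vectors_of_pow_three h2 (n := 3) hs hcard
  choose e he using hv'
  exact hsq5 ((isSquare_of_three_entries h2 h3 (hv 0) (hv 1) (hv 2) (he 0 1 (by decide))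
    (he 0 2 (by decide)) (he 1 2 (by decide))).resolve_left hsq).2.2.2

end OrderThreeBounds

/-! ### Involutions outside `PSL(2, F)` -/

section Involutions

variable {F : Type*} [Field F]

theorem mul_mem_pslSubgroup_of_not_mem [Finite F] {f g : PGL(2, F)} (hf : f ∉ pslSubgroup F)
    (hg : g ∉ pslSubgroup F) : f * g ∈ pslSubgroup F := by
  obtain ⟨A, hA, rfl⟩ := exists_eq_proj f
  obtain ⟨C, hC, rfl⟩ := exists_eq_proj g
  rw [proj_mul, proj_mem_pslSubgroup_iff, Matrix.det_mul]
  exact isSquare_mul_of_not_isSquare (mt proj_mem_pslSubgroup_iff.2 hf)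
    (mt proj_mem_pslSubgroup_iff.2 hg)

theorem inv_mul_mem_pslSubgroup_of_not_mem [Finite F] {f g : PGL(2, F)} (hf : f ∉ pslSubgroup F)
    (hg : g ∉ pslSubgroup F) : f⁻¹ * g ∈ pslSubgroup F :=
  mul_mem_pslSubgroup_of_not_mem (by rwa [inv_mem_iff]) hg

/-- The trace zero matrix with coordinates `v`. -/
def traceZeroMatrix (v : Fin 3 → F) : Matrix (Fin 2) (Fin 2) F := !![v 0, v 1; v 2, -v 0]

theorem det_traceZeroMatrix (v : Fin 3 → F) :
    2 * (traceZeroMatrix v).det = traceZeroForm v v := by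
  simp only [traceZeroMatrix, traceZeroForm, Matrix.det_fin_two_of]
  ring

theorem polar_traceZeroMatrix (v w : Fin 3 → F) :
    polar (traceZeroMatrix v) (traceZeroMatrix w) = traceZeroForm v w := by
  simp [traceZeroMatrix, traceZeroForm, polar]
  ring

/-- An element of `PGL(2, F)` outside `PSL(2, F)` that lies in `vertexFixing F` is represented by
a trace zero matrix, whose determinant can be any prescribed nonsquare. -/
theorem exists_traceZeroMatrix [Finite F] {d : F} (hd : ¬ IsSquare d) {g : PGL(2, F)}
    (hg : g ∈ vertexFixing F) (hg' : g ∉ pslSubgroup F) :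
    ∃ (v : Fin 3 → F) (hv : (traceZeroMatrix v).det ≠ 0), (traceZeroMatrix v).det = d ∧
      g = proj (traceZeroMatrix v) hv := by
  have hg2 : g ^ 2 = 1 := (hg.resolve_left fun h => hg' (mem_pslSubgroup_of_pow_three h)).1
  have hg1 : g ≠ 1 := by rintro rfl; exact hg' (one_mem _)
  have hd0 : d ≠ 0 := by rintro rfl; exact hd IsSquare.zero
  obtain ⟨A, hA, rfl⟩ := exists_eq_proj g
  have htr := (proj_sq_eq_one_iff.1 hg2).resolve_left hg1
  obtain ⟨u, hu⟩ := isSquare_mul_of_not_isSquare (mt proj_mem_pslSubgroup_iff.2 hg') hd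
  have hu0 : u ≠ 0 := by
    rintro rfl
    rw [mul_zero] at hu
    exact mul_ne_zero hA hd0 hu
  set t := u / A.det with ht
  have ht0 : t ≠ 0 := div_ne_zero hu0 hA
  have hm : traceZeroMatrix ![t * A 0 0, t * A 0 1, t * A 1 0] = t • A := by
    rw [Matrix.trace_fin_two] at htr
    ext i j
    fin_cases i <;> fin_cases j <;> simp [traceZeroMatrix]
    linear_combination -t * htr
  have hdet : (t • A).det = d := by
    rw [Matrix.det_smul, ht]
    simp
    field_simp
    linear_combination -hu
  refine ⟨![t * A 0 0, t * A 0 1, t * A 1 0], ?_, ?_, ?_⟩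
  · rwa [hm, hdet]
  · rw [hm, hdet]
  · exact proj_eq_proj_iff.2 ⟨t, ht0, hm⟩

/-- A sign, as an integer. -/
def signEntry (e : Bool) : ℤ := if e then 1 else -1

theorem exists_signEntry [Finite F] {d : F} {v w : Fin 3 → F}
    {hv : (traceZeroMatrix v).det ≠ 0} {hw : (traceZeroMatrix w).det ≠ 0}
    (hvd : (traceZeroMatrix v).det = d) (hwd : (traceZeroMatrix w).det = d)
    (hne : proj (traceZeroMatrix v) hv ≠ proj (traceZeroMatrix w) hw)
    (h : ((proj (traceZeroMatrix v) hv)⁻¹ * proj (traceZeroMatrix w) hw) ^ 3 = 1) :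
    ∃ e : Bool, traceZeroForm v w = d * (signEntry e : F) := by
  have h' := (pow_three_inv_mul_iff.1 h).resolve_left hne
  rw [polar_traceZeroMatrix, hvd, hwd, ← sq, sq_eq_sq_iff_eq_or_eq_neg] at h'
  rcases h' with h' | h'
  · exact ⟨true, by simp [h', signEntry]⟩
  · exact ⟨false, by simp [h', signEntry]⟩

theorem symmDetFour_signEntry_dvd : ∀ a b c e f g : Bool,
    symmDetFour 2 (signEntry a) (signEntry b) (signEntry c) (signEntry e) (signEntry f)
      (signEntry g) ∣ 3 ^ 3 * 5 := by
  decide +kernel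

theorem signEntry_mul_eq_one_of_five_dvd : ∀ a b c e f g : Bool,
    symmDetFour 2 (signEntry a) (signEntry b) (signEntry c) (signEntry e) (signEntry f)
      (signEntry g) % 5 = 0 → signEntry a * signEntry b * signEntry e = 1 ∧
      signEntry a * signEntry c * signEntry f = 1 ∧
      signEntry b * signEntry c * signEntry g = 1 := by
  decide +kernel

/-- Four trace zero matrices of nonsquare determinant, with quotients of order three, exist only
in characteristic five, where the inner products of any three of them have the sign pattern of an
equiangular triple with nonzero Gram determinant. -/
theorem signEntry_mul_eq_one [Finite F] (h3 : (3 : F) ≠ 0) {d : F} (hd : d ≠ 0)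
    {v : Fin 4 → Fin 3 → F} (hv : ∀ i, traceZeroForm (v i) (v i) = d * 2) {a b c e f g : Bool}
    (ha : traceZeroForm (v 0) (v 1) = d * (signEntry a : F))
    (hb : traceZeroForm (v 0) (v 2) = d * (signEntry b : F))
    (hc : traceZeroForm (v 0) (v 3) = d * (signEntry c : F))
    (he : traceZeroForm (v 1) (v 2) = d * (signEntry e : F))
    (hf : traceZeroForm (v 1) (v 3) = d * (signEntry f : F))
    (hg : traceZeroForm (v 2) (v 3) = d * (signEntry g : F)) :
    signEntry a * signEntry b * signEntry e = 1 ∧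
      signEntry a * signEntry c * signEntry f = 1 ∧
      signEntry b * signEntry c * signEntry g = 1 := by
  have h := symmDetFour_traceZeroForm_eq_zero v (d * 2) hv
  rw [ha, hb, hc, he, hf, hg, symmDetFour_mul] at h
  have h' := (mul_eq_zero.1 h).resolve_left (pow_ne_zero _ hd)
  rw [show (2 : F) = ((2 : ℤ) : F) by norm_num, symmDetFour_intCast] at h'
  have h5 : (5 : F) = 0 := by
    obtain ⟨m, hm⟩ := symmDetFour_signEntry_dvd a b c e f g
    have h0 : ((3 ^ 3 * 5 : ℤ) : F) = 0 := by rw [hm, Int.cast_mul, h', zero_mul]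
    push_cast at h0
    have h0' : (3 : F) ^ 3 * 5 = 0 := by linear_combination h0
    exact (mul_eq_zero.1 h0').resolve_left (pow_ne_zero 3 h3)
  have := charP_five h5
  rw [CharP.intCast_eq_zero_iff F 5] at h'
  exact signEntry_mul_eq_one_of_five_dvd a b c e f g (Int.emod_eq_zero_of_dvd h')

theorem det_ne_zero_of_signEntry (h2 : (2 : F) ≠ 0) {d : F} (hd : d ≠ 0) {u v w : Fin 3 → F}
    (hu : traceZeroForm u u = d * 2) (hv : traceZeroForm v v = d * 2)
    (hw : traceZeroForm w w = d * 2) {a b c : Bool}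
    (ha : traceZeroForm u v = d * (signEntry a : F))
    (hb : traceZeroForm u w = d * (signEntry b : F))
    (hc : traceZeroForm v w = d * (signEntry c : F))
    (h : signEntry a * signEntry b * signEntry c = 1) : (Matrix.of ![u, v, w]).det ≠ 0 := by
  intro h0
  have hg := gram_three u v w
  have h' : (signEntry a : F) * signEntry b * signEntry c = 1 := by
    rw [← Int.cast_mul, ← Int.cast_mul, h, Int.cast_one]
  have hs : ∀ x : Bool, (signEntry x : F) ^ 2 = 1 := by
    intro x; cases x <;> simp [signEntry]
  rw [h0, hu, hv, hw, ha, hb, hc] at hg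
  have : d ^ 3 * 2 ^ 2 = 0 := by
    linear_combination -hg - 2 * d ^ 3 * h' + 2 * d ^ 3 * (hs a + hs b + hs c)
  exact mul_ne_zero (pow_ne_zero 3 hd) (pow_ne_zero 2 h2) this

end Involutions

/-! ### Intersecting sets in `PGL(2, F)` -/

section MixedBounds

variable {F : Type*} [Field F] [Finite F]

/-- The configuration formed by elements `x i` of an intersecting set and an element `w` of it in
the other coset of `PSL(2, F)`: after translating `w` to the identity, the `x i` become trace zero
matrices. -/
theorem exists_vectors_of_mixed {d : F} (hd : ¬ IsSquare d) {n : ℕ} {x : Fin n → PGL(2, F)}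
    (hx : Function.Injective x) (hx3 : ∀ i j, ((x i)⁻¹ * x j) ^ 3 = 1) {w : PGL(2, F)}
    (hw : ∀ i, w⁻¹ * x i ∈ vertexFixing F) (hw' : ∀ i, w⁻¹ * x i ∉ pslSubgroup F) :
    ∃ (v : Fin n → Fin 3 → F) (hv : ∀ i, (traceZeroMatrix (v i)).det ≠ 0),
      (∀ i, w⁻¹ * x i = proj (traceZeroMatrix (v i)) (hv i)) ∧
      (∀ i, traceZeroForm (v i) (v i) = d * 2) ∧
      ∀ i j, i ≠ j → ∃ e : Bool, traceZeroForm (v i) (v j) = d * (signEntry e : F) := by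
  choose v hv hvd hvx using fun i => exists_traceZeroMatrix hd (hw i) (hw' i)
  refine ⟨v, hv, hvx, fun i => ?_, fun i j hij => ?_⟩
  · rw [← det_traceZeroMatrix, hvd, mul_comm]
  · refine exists_signEntry (hvd i) (hvd j) (hv := hv i) (hw := hv j) ?_ ?_
    · rw [← hvx, ← hvx]
      exact fun h => hij (hx (mul_left_cancel h))
    · rw [← hvx, ← hvx]
      simpa [mul_assoc] using hx3 i j

theorem exists_not_isSquare (h2 : (2 : F) ≠ 0) : ∃ d : F, ¬ IsSquare d :=
  FiniteField.exists_nonsquare fun h => h2 (by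
    have := ringChar.of_eq h
    exact_mod_cast CharP.cast_eq_zero F 2)

/-- A quotient of two elements `w`, `w'` of the other coset is orthogonal to the trace zero matrices
`w⁻¹ * x i`, which span, so that it is scalar. -/
theorem not_four_and_two (h2 : (2 : F) ≠ 0) (h3 : (3 : F) ≠ 0) {x : Fin 4 → PGL(2, F)}
    (hx : Function.Injective x) (hx3 : ∀ i j, ((x i)⁻¹ * x j) ^ 3 = 1) {w w' : PGL(2, F)}
    (hww' : w ≠ w')
    (hw : ∀ i, w⁻¹ * x i ∈ vertexFixing F ∧ w⁻¹ * x i ∉ pslSubgroup F)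
    (hw' : ∀ i, w'⁻¹ * x i ∈ vertexFixing F ∧ w'⁻¹ * x i ∉ pslSubgroup F) : False := by
  obtain ⟨d, hd⟩ := exists_not_isSquare h2
  have hd0 : d ≠ 0 := by rintro rfl; exact hd IsSquare.zero
  obtain ⟨v, hv, hvx, hvd, hvv⟩ :=
    exists_vectors_of_mixed hd hx hx3 (fun i => (hw i).1) (fun i => (hw i).2)
  choose e he using hvv
  have h1 := signEntry_mul_eq_one h3 hd0 hvd (he 0 1 (by decide)) (he 0 2 (by decide))
    (he 0 3 (by decide)) (he 1 2 (by decide)) (he 1 3 (by decide)) (he 2 3 (by decide))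
  have hdet := det_ne_zero_of_signEntry h2 hd0 (hvd 0) (hvd 1) (hvd 2) (he 0 1 (by decide))
    (he 0 2 (by decide)) (he 1 2 (by decide)) h1.1
  obtain ⟨Z, hZ, hZw⟩ := exists_eq_proj (w⁻¹ * w')
  set z : Fin 3 → F := ![(Z 0 0 - Z 1 1) / 2, Z 0 1, Z 1 0] with hz
  have hperp : ∀ i, traceZeroForm (v i) z = 0 := by
    intro i
    have hmem : (proj Z hZ)⁻¹ * proj (traceZeroMatrix (v i)) (hv i) ∈ vertexFixing F ∧
        (proj Z hZ)⁻¹ * proj (traceZeroMatrix (v i)) (hv i) ∉ pslSubgroup F := by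
      rw [← hZw, ← hvx]
      simpa [mul_assoc] using hw' i
    have hp : polar Z (traceZeroMatrix (v i)) = 0 := by
      rcases inv_mul_mem_vertexFixing_iff.1 hmem.1 with h | h | h
      · rw [h, inv_mul_cancel] at hmem
        exact absurd (one_mem _) hmem.2
      · exact absurd (mem_pslSubgroup_of_pow_three (pow_three_inv_mul_iff.2 (Or.inr h))) hmem.2
      · exact h.1
    rw [← hp, polar, traceZeroForm, traceZeroMatrix, hz]
    simp
    field_simp
    ring
  have hz0 := eq_zero_of_traceZeroForm_eq_zero h2 hdet (hperp 0) (hperp 1) (hperp 2)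
  have a0 := congrFun hz0 0
  have a1 := congrFun hz0 1
  have a2 := congrFun hz0 2
  simp [hz, h2] at a0 a1 a2
  apply hww'
  rw [← inv_mul_eq_one, hZw, proj_eq_one_iff]
  exact ⟨a1, a2, sub_eq_zero.1 a0⟩

/-- Up to signs, the fourth and the fifth trace zero matrix have the same inner products with the
first three, which span. -/
theorem not_five_and_one (h2 : (2 : F) ≠ 0) (h3 : (3 : F) ≠ 0) {x : Fin 5 → PGL(2, F)}
    (hx : Function.Injective x) (hx3 : ∀ i j, ((x i)⁻¹ * x j) ^ 3 = 1) {w : PGL(2, F)}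
    (hw : ∀ i, w⁻¹ * x i ∈ vertexFixing F ∧ w⁻¹ * x i ∉ pslSubgroup F) : False := by
  obtain ⟨d, hd⟩ := exists_not_isSquare h2
  have hd0 : d ≠ 0 := by rintro rfl; exact hd IsSquare.zero
  obtain ⟨v, hv, hvx, hvd, hvv⟩ :=
    exists_vectors_of_mixed hd hx hx3 (fun i => (hw i).1) (fun i => (hw i).2)
  choose e he using hvv
  obtain ⟨h012, h013, h023⟩ := signEntry_mul_eq_one h3 hd0 (v := ![v 0, v 1, v 2, v 3])
    (by intro m; fin_cases m <;> exact hvd _) (he 0 1 (by decide)) (he 0 2 (by decide))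
    (he 0 3 (by decide)) (he 1 2 (by decide)) (he 1 3 (by decide)) (he 2 3 (by decide))
  obtain ⟨-, h014, h024⟩ := signEntry_mul_eq_one h3 hd0 (v := ![v 0, v 1, v 2, v 4])
    (by intro m; fin_cases m <;> exact hvd _) (he 0 1 (by decide)) (he 0 2 (by decide))
    (he 0 4 (by decide)) (he 1 2 (by decide)) (he 1 4 (by decide)) (he 2 4 (by decide))
  have hdet := det_ne_zero_of_signEntry h2 hd0 (hvd 0) (hvd 1) (hvd 2) (he 0 1 (by decide))
    (he 0 2 (by decide)) (he 1 2 (by decide)) h012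
  have hs : ∀ x : Bool, (signEntry x : F) ^ 2 = 1 := by
    intro x; cases x <;> simp [signEntry]
  -- With signs chosen so that their products with `v 0` agree, `v 3` and `v 4` have the same
  -- products with `v 0`, `v 1` and `v 2`.
  set y : Fin 3 → F := fun i => (signEntry (e 0 3 (by decide)) : F) * v 3 i
    - (signEntry (e 0 4 (by decide)) : F) * v 4 i with hy
  have hlin : ∀ u, traceZeroForm u y = (signEntry (e 0 3 (by decide)) : F) * traceZeroForm u (v 3)
      - (signEntry (e 0 4 (by decide)) : F) * traceZeroForm u (v 4) := by
    intro u; simp only [traceZeroForm, hy]; ring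
  have g013 := congrArg (Int.cast : ℤ → F) h013
  have g014 := congrArg (Int.cast : ℤ → F) h014
  have g023 := congrArg (Int.cast : ℤ → F) h023
  have g024 := congrArg (Int.cast : ℤ → F) h024
  push_cast at g013 g014 g023 g024
  have hy0 : y = 0 := by
    refine eq_zero_of_traceZeroForm_eq_zero h2 hdet ?_ ?_ ?_
    · rw [hlin, he 0 3 (by decide), he 0 4 (by decide)]
      linear_combination d * hs (e 0 3 (by decide)) - d * hs (e 0 4 (by decide))
    · rw [hlin, he 1 3 (by decide), he 1 4 (by decide)]
      have := hs (e 0 1 (by decide))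
      linear_combination d * (signEntry (e 0 1 (by decide)) : F) * (g013 - g014) - d * this *
        ((signEntry (e 0 3 (by decide)) : F) * (signEntry (e 1 3 (by decide)) : F) -
        (signEntry (e 0 4 (by decide)) : F) * (signEntry (e 1 4 (by decide)) : F))
    · rw [hlin, he 2 3 (by decide), he 2 4 (by decide)]
      have := hs (e 0 2 (by decide))
      linear_combination d * (signEntry (e 0 2 (by decide)) : F) * (g023 - g024) - d * this *
        ((signEntry (e 0 3 (by decide)) : F) * (signEntry (e 2 3 (by decide)) : F) -
        (signEntry (e 0 4 (by decide)) : F) * (signEntry (e 2 4 (by decide)) : F))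
  have h34 : proj (traceZeroMatrix (v 3)) (hv 3) = proj (traceZeroMatrix (v 4)) (hv 4) := by
    rw [proj_eq_proj_iff]
    refine ⟨(signEntry (e 0 4 (by decide)) : F) * (signEntry (e 0 3 (by decide)) : F), ?_, ?_⟩
    · intro h
      have := congrArg (· ^ 2) h
      simp [mul_pow, hs] at this
    · have hv4 : ∀ i, v 4 i = (signEntry (e 0 4 (by decide)) : F) *
          (signEntry (e 0 3 (by decide)) : F) * v 3 i := by
        intro i
        have h1 := congrFun hy0 i
        simp only [hy, Pi.zero_apply] at h1
        linear_combination (-(signEntry (e 0 4 (by decide)) : F)) * h1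
          - v 4 i * hs (e 0 4 (by decide))
      ext i j
      fin_cases i <;> fin_cases j <;> simp [traceZeroMatrix, hv4]
  rw [← hvx, ← hvx] at h34
  exact absurd (hx (mul_left_cancel h34)) (by decide)

/-- An intersecting set of `PGL(2, F)` has at most six elements, in characteristic other than two
and three. -/
theorem card_le_six_of_vertexFixing {s : Finset PGL(2, F)} (h2 : (2 : F) ≠ 0) (h3 : (3 : F) ≠ 0)
    (hs : ∀ f ∈ s, ∀ g ∈ s, f⁻¹ * g ∈ vertexFixing F) : s.card ≤ 6 := by
  classical
  -- No intersecting set has at least four elements in one coset and at least seven in total.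
  have main : ∀ t u : Finset PGL(2, F), t ∪ u = s → t.card + u.card = s.card →
      (∀ f ∈ t, ∀ g ∈ t, f⁻¹ * g ∈ pslSubgroup F) →
      (∀ f ∈ u, ∀ g ∈ t, f⁻¹ * g ∉ pslSubgroup F) → 4 ≤ t.card → s.card ≤ 6 := by
    intro t u htu hcard ht htu' h4
    by_contra! h7
    have hts : t ⊆ s := htu ▸ Finset.subset_union_left
    have hus : u ⊆ s := htu ▸ Finset.subset_union_right
    have ht3 : ∀ f ∈ t, ∀ g ∈ t, (f⁻¹ * g) ^ 3 = 1 := fun f hf g hg =>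
      pow_three_of_mem_vertexFixing (hs f (hts hf) g (hts hg)) (ht f hf g hg)
    have ht6 := card_le_six_of_pow_three h2 h3 ht3
    have hmix : ∀ f ∈ u, ∀ g ∈ t, f⁻¹ * g ∈ vertexFixing F ∧ f⁻¹ * g ∉ pslSubgroup F :=
      fun f hf g hg => ⟨hs f (hus hf) g (hts hg), htu' f hf g hg⟩
    by_cases hu2 : 2 ≤ u.card
    · obtain ⟨x, hx, hxt⟩ := exists_injective_fin_mem h4
      obtain ⟨w, hw, w', hw', hne⟩ := Finset.one_lt_card.1 hu2
      exact not_four_and_two h2 h3 hx (fun i j => ht3 _ (hxt i) _ (hxt j)) hne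
        (fun i => hmix w hw _ (hxt i)) (fun i => hmix w' hw' _ (hxt i))
    · obtain ⟨x, hx, hxt⟩ := exists_injective_fin_mem (s := t) (n := 5) (by omega)
      obtain ⟨w, hw⟩ : u.Nonempty := Finset.card_pos.1 (by omega)
      exact not_five_and_one h2 h3 hx (fun i j => ht3 _ (hxt i) _ (hxt j))
        (fun i => hmix w hw _ (hxt i))
  have hin : ∀ f ∈ s.filter (· ∈ pslSubgroup F), f ∈ pslSubgroup F := fun f hf =>
    (Finset.mem_filter.1 hf).2
  have hout : ∀ f ∈ s.filter (· ∉ pslSubgroup F), f ∉ pslSubgroup F := fun f hf =>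
    (Finset.mem_filter.1 hf).2
  have hsum := Finset.card_filter_add_card_filter_not (s := s) (· ∈ pslSubgroup F)
  have hunion := Finset.filter_union_filter_not_eq (· ∈ pslSubgroup F) s
  have h1 : ∀ f ∈ s.filter (· ∈ pslSubgroup F), ∀ g ∈ s.filter (· ∈ pslSubgroup F),
      f⁻¹ * g ∈ pslSubgroup F := fun f hf g hg => mul_mem (inv_mem (hin f hf)) (hin g hg)
  have h2' : ∀ f ∈ s.filter (· ∉ pslSubgroup F), ∀ g ∈ s.filter (· ∉ pslSubgroup F),
      f⁻¹ * g ∈ pslSubgroup F := fun f hf g hg =>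
    inv_mul_mem_pslSubgroup_of_not_mem (hout f hf) (hout g hg)
  by_cases h : 4 ≤ (s.filter (· ∈ pslSubgroup F)).card
  · refine main _ _ hunion hsum h1 (fun f hf g hg hfg => hout f hf ?_) h
    have := mul_mem (hin g hg) (inv_mem hfg)
    simpa using this
  · by_cases h' : 4 ≤ (s.filter (· ∉ pslSubgroup F)).card
    · refine main _ _ (by rw [Finset.union_comm]; exact hunion) (by omega) h2'
        (fun f hf g hg hfg => hout g hg ?_) h'
      have := mul_mem (hin f hf) hfg
      simpa using this
    · omega

end MixedBounds

/-! ### Constructions of intersecting sets -/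

section Constructions

variable {F : Type*} [Field F]

theorem polar_comm (A C : Matrix (Fin 2) (Fin 2) F) : polar A C = polar C A := by
  simp only [polar]; ring

/-- Equiangular lines give an intersecting set in `PSL(2, F)`. Distinct lines are automatic, because
parallel vectors of determinant one have inner product `2` or `-2`, whose square is not `1`. -/
theorem exists_finset_of_polar (h3 : (3 : F) ≠ 0) {n : ℕ} (A : Fin n → Matrix (Fin 2) (Fin 2) F)
    (hdet : ∀ i, (A i).det = 1) (hpol : ∀ i j, i < j → polar (A i) (A j) ^ 2 = 1) :
    ∃ s : Finset PGL(2, F), (∀ f ∈ s, f ∈ pslSubgroup F) ∧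
      (∀ f ∈ s, ∀ g ∈ s, f⁻¹ * g ∈ vertexFixing F) ∧ s.card = n := by
  classical
  have hpol' : ∀ i j, i ≠ j → polar (A i) (A j) ^ 2 = 1 := by
    intro i j hij
    rcases lt_or_gt_of_ne hij with h | h
    · exact hpol i j h
    · rw [polar_comm]; exact hpol j i h
  have hne : ∀ i, (A i).det ≠ 0 := fun i => by rw [hdet]; exact one_ne_zero
  have hinj : Function.Injective fun i => proj (A i) (hne i) := by
    intro i j hij
    by_contra h
    obtain ⟨u, -, hu⟩ := proj_eq_proj_iff.1 hij
    have h1 := hpol' i j h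
    have h2 := hdet j
    have hsmul : polar (A i) (u • A i) = 2 * u * (A i).det := by
      rw [Matrix.det_fin_two]
      simp [polar]
      ring
    rw [hu, hsmul, hdet] at h1
    rw [hu, Matrix.det_smul, hdet, Fintype.card_fin] at h2
    apply h3
    linear_combination h1 - 4 * h2
  refine ⟨Finset.univ.image fun i => proj (A i) (hne i), ?_, ?_, ?_⟩
  · intro f hf
    obtain ⟨i, -, rfl⟩ := Finset.mem_image.1 hf
    rw [proj_mem_pslSubgroup_iff, hdet]
    exact IsSquare.one
  · intro f hf g hg
    obtain ⟨i, -, rfl⟩ := Finset.mem_image.1 hf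
    obtain ⟨j, -, rfl⟩ := Finset.mem_image.1 hg
    rw [inv_mul_mem_vertexFixing_iff]
    by_cases hij : i = j
    · left; rw [hij]
    · right; left; rw [hdet, hdet, hpol' i j hij, mul_one]
  · rw [Finset.card_image_of_injective _ hinj, Finset.card_univ, Fintype.card_fin]

theorem exists_card_eq_four_of_cube_root (h3 : (3 : F) ≠ 0) {ω : F} (hω : ω ^ 2 + ω + 1 = 0) :
    ∃ s : Finset PGL(2, F), (∀ f ∈ s, f ∈ pslSubgroup F) ∧
      (∀ f ∈ s, ∀ g ∈ s, f⁻¹ * g ∈ vertexFixing F) ∧ s.card = 4 := by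
  refine exists_finset_of_polar h3 ![1, !![ω, 0; 0, ω ^ 2], !![ω ^ 2, 1; 0, ω],
    !![ω ^ 2, 0; 1, ω]] ?_ ?_
  · intro i
    fin_cases i <;> simp [Matrix.det_fin_two] <;> grind
  · intro i j hij
    fin_cases i <;> fin_cases j <;> simp at hij <;> simp [polar] <;> grind

/-- The six equiangular lines in characteristic five extend the four of
`exists_card_eq_four_of_cube_root`. -/
theorem exists_card_eq_six (h5 : (5 : F) = 0) (h3 : (3 : F) ≠ 0) {ω : F}
    (hω : ω ^ 2 + ω + 1 = 0) :
    ∃ s : Finset PGL(2, F), (∀ f ∈ s, f ∈ pslSubgroup F) ∧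
      (∀ f ∈ s, ∀ g ∈ s, f⁻¹ * g ∈ vertexFixing F) ∧ s.card = 6 := by
  refine exists_finset_of_polar h3 ![1, !![ω, 0; 0, ω ^ 2], !![ω ^ 2, 1; 0, ω],
    !![ω ^ 2, 0; 1, ω], !![3 + 2 * ω, 1; 1, 1 + 3 * ω], !![3 + 2 * ω, -1; -1, 1 + 3 * ω]] ?_ ?_
  · intro i
    fin_cases i <;> simp [Matrix.det_fin_two] <;> grind
  · intro i j hij
    fin_cases i <;> fin_cases j <;> simp at hij <;> simp [polar] <;> grind

/-- The quaternion `(1 + w 0 i + w 1 j + w 2 k) / 2` as a matrix, where `x ^ 2 + y ^ 2 = -1`. -/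
def halfQuaternion (x y : F) (w : Fin 3 → F) : Matrix (Fin 2) (Fin 2) F :=
  !![(1 + w 1 * x - w 2 * y) / 2, (-w 0 + w 1 * y + w 2 * x) / 2;
     (w 0 + w 1 * y + w 2 * x) / 2, (1 - w 1 * x + w 2 * y) / 2]

theorem polar_halfQuaternion (h2 : (2 : F) ≠ 0) {x y : F} (hxy : x ^ 2 + y ^ 2 = -1)
    (w z : Fin 3 → F) : polar (halfQuaternion x y w) (halfQuaternion x y z) =
      (1 + w 0 * z 0 + w 1 * z 1 + w 2 * z 2) / 2 := by
  simp [polar, halfQuaternion]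
  field_simp
  linear_combination (-2 * (w 1 * z 1 + w 2 * z 2)) * hxy

theorem two_mul_det_eq_polar (A : Matrix (Fin 2) (Fin 2) F) : 2 * A.det = polar A A := by
  rw [Matrix.det_fin_two, polar]; ring

/-- The set lies in the icosahedral group, a copy of the alternating group of degree five, where
`{1, (1 2 3), (1 2 4), (1 2 5)}` is an example of four elements with quotients of order three. It is
written in quaternions, with the golden ratio `t`. -/
theorem exists_card_eq_four_of_isSquare_five [Finite F] (h2 : (2 : F) ≠ 0) (h3 : (3 : F) ≠ 0)
    (h5 : IsSquare (5 : F)) :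
    ∃ s : Finset PGL(2, F), (∀ f ∈ s, f ∈ pslSubgroup F) ∧
      (∀ f ∈ s, ∀ g ∈ s, f⁻¹ * g ∈ vertexFixing F) ∧ s.card = 4 := by
  obtain ⟨r, hr⟩ := h5
  obtain ⟨x, y, hxy⟩ : ∃ x y : F, x ^ 2 + y ^ 2 = -1 := by
    have : NeZero (ringChar F) := ⟨CharP.ringChar_ne_zero_of_finite F⟩
    obtain ⟨a, b, h⟩ := CharP.sq_add_sq F (ringChar F) (-1)
    exact ⟨a, b, by simpa using h⟩
  set t := (1 + r) / 2 with ht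
  have ht' : t ^ 2 = t + 1 := by
    rw [ht]; field_simp; linear_combination -hr
  have hone : ∀ w, polar 1 (halfQuaternion x y w) = 1 := by
    intro w
    simp [polar, halfQuaternion]
    field_simp
    ring
  have hdet : ∀ w, w 0 ^ 2 + w 1 ^ 2 + w 2 ^ 2 = 3 → (halfQuaternion x y w).det = 1 := by
    intro w hw
    apply mul_left_cancel₀ h2
    rw [two_mul_det_eq_polar, polar_halfQuaternion h2 hxy]
    field_simp
    linear_combination hw
  refine exists_finset_of_polar h3 ![1, halfQuaternion x y ![1, 1, 1],
    halfQuaternion x y ![1, 1, -1], halfQuaternion x y ![t, 1 - t, 0]] ?_ ?_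
  · intro i
    fin_cases i
    · simp
    · apply hdet; simp; ring
    · apply hdet; simp; ring
    · apply hdet; simp; linear_combination 2 * ht'
  · have h : ∀ w z : Fin 3 → F, w 0 * z 0 + w 1 * z 1 + w 2 * z 2 = 1 →
        polar (halfQuaternion x y w) (halfQuaternion x y z) ^ 2 = 1 := by
      intro w z hwz
      rw [polar_halfQuaternion h2 hxy, add_assoc, add_assoc, ← add_assoc (w 0 * z 0), hwz]
      field_simp
      norm_num
    intro i j hij
    fin_cases i <;> fin_cases j <;> simp at hij
    · simp [hone]
    · simp [hone]
    · simp [hone]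
    · apply h; simp
    · apply h; simp
    · apply h; simp

end Constructions

/-! ### Characteristic three -/

section CharThree

variable {F : Type*} [Field F]

/-- Orthogonal isotropic vectors are parallel. -/
theorem mul_eq_mul_of_isotropic {v w : Fin 3 → F} (hv : traceZeroForm v v = 0)
    (hw : traceZeroForm w w = 0) (hvw : traceZeroForm v w = 0) (h2 : (2 : F) ≠ 0) (i j : Fin 3) :
    v i * w j = v j * w i := by
  have hv' : v 0 ^ 2 = -(v 1 * v 2) :=
    mul_left_cancel₀ h2 (by rw [traceZeroForm] at hv; linear_combination -hv)
  have hw' : w 0 ^ 2 = -(w 1 * w 2) :=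
    mul_left_cancel₀ h2 (by rw [traceZeroForm] at hw; linear_combination -hw)
  rw [traceZeroForm] at hvw
  have h01 : v 0 * w 1 = v 1 * w 0 := by
    rw [← sub_eq_zero]
    refine pow_eq_zero_iff (two_ne_zero) |>.1 ?_
    linear_combination w 1 ^ 2 * hv' + v 1 ^ 2 * hw' + v 1 * w 1 * hvw
  have h02 : v 0 * w 2 = v 2 * w 0 := by
    rw [← sub_eq_zero]
    refine pow_eq_zero_iff (two_ne_zero) |>.1 ?_
    linear_combination w 2 ^ 2 * hv' + v 2 ^ 2 * hw' + v 2 * w 2 * hvw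
  have h12 : v 1 * w 2 = v 2 * w 1 := by
    rw [← sub_eq_zero]
    refine pow_eq_zero_iff (two_ne_zero) |>.1 ?_
    linear_combination 4 * w 0 ^ 2 * hv' - 4 * v 1 * v 2 * hw' +
      (2 * v 0 * w 0 - v 1 * w 2 - v 2 * w 1) * hvw
  fin_cases i <;> fin_cases j <;> simp <;>
    first | assumption | exact h01.symm | exact h02.symm | exact h12.symm

theorem three_le_card [Finite F] (h2 : (2 : F) ≠ 0) : 3 ≤ Nat.card F := by
  have hinj : Function.Injective (![0, 1, -1] : Fin 3 → F) := by
    have h11 : (1 : F) ≠ -1 := fun h => h2 (by linear_combination h)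
    intro i j hij
    fin_cases i <;> fin_cases j <;> simp [h11, h11.symm] at hij ⊢
  simpa using Nat.card_le_card_of_injective _ hinj

/-- In characteristic three, if `-1` is not a square, sets with unipotent quotients have at most
`q` elements: such a set lies in a coset of a Sylow subgroup unless it has at most three
elements. -/
theorem card_le_card_field [Finite F] {s : Finset PGL(2, F)} (h3 : (3 : F) = 0)
    (hsq : ¬ IsSquare (-1 : F)) (hs : ∀ f ∈ s, ∀ g ∈ s, (f⁻¹ * g) ^ 3 = 1) :
    s.card ≤ Nat.card F := by
  have h2 : (2 : F) ≠ 0 := fun h => one_ne_zero (α := F) (by linear_combination h3 - h)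
  by_contra! hcard
  have hn : (s.card - 1) + 1 ≤ s.card := by omega
  obtain ⟨v, hinj, hv0, hv, hvv⟩ := exists_vectors_of_pow_three h2 hs hn
  have hiso : ∀ i, traceZeroForm (v i) (v i) = 0 := fun i => by rw [hv, h3, mul_zero]
  have hvals : ∀ i j, i ≠ j → traceZeroForm (v i) (v j) = 0 ∨ traceZeroForm (v i) (v j) = -1 := by
    intro i j hij
    obtain ⟨e, he⟩ := hvv i j hij
    cases e <;> simp [orderThreeEntry] at he
    · left; rw [he]; linear_combination -2 * h3
    · right; rw [he]; linear_combination h3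
  have hq := three_le_card h2
  by_cases hall : ∀ i j, i ≠ j → traceZeroForm (v i) (v j) = 0
  · obtain ⟨l, hl⟩ := Function.ne_iff.1 (hv0 ⟨0, by omega⟩)
    rw [Pi.zero_apply] at hl
    have hpar : ∀ i m, v ⟨0, by omega⟩ l * v i m = v ⟨0, by omega⟩ m * v i l := by
      intro i m
      by_cases hi : i = ⟨0, by omega⟩
      · rw [hi, mul_comm]
      · exact mul_eq_mul_of_isotropic (hiso _) (hiso _) (hall _ _ (Ne.symm hi)) h2 _ _
    have hpar0 : ∀ i, v i l ≠ 0 := by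
      intro i h
      apply hv0 i
      ext m
      have := hpar i m
      rw [h, mul_zero] at this
      exact (mul_eq_zero.1 this).resolve_left hl
    have hparinj : Function.Injective fun o : Option (Fin (s.card - 1)) =>
        o.elim (0 : F) (fun i => v i l) := by
      rintro (_ | i) (_ | j) hij
      · rfl
      · exact absurd hij.symm (hpar0 j)
      · exact absurd hij (hpar0 i)
      · simp only [Option.elim] at hij
        congr 1
        apply hinj
        ext m
        apply mul_left_cancel₀ hl
        rw [hpar, hpar, hij]
    have := Nat.card_le_card_of_injective _ hparinj
    simp at this
    omega
  · push Not at hall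
    obtain ⟨i, j, hij, hne⟩ := hall
    have hij1 := (hvals i j hij).resolve_left hne
    obtain ⟨k, hk⟩ : ∃ k : Fin (s.card - 1), k ∉ ({i, j} : Finset _) := by
      by_contra! hk
      have := Finset.card_le_card (fun k _ => hk k : Finset.univ ⊆ ({i, j} : Finset _))
      rw [Finset.card_univ, Fintype.card_fin] at this
      have := this.trans Finset.card_le_two
      omega
    simp at hk
    have key : ∀ i j, i ≠ j → traceZeroForm (v i) (v j) = -1 → ∀ k, k ≠ i → k ≠ j →
        traceZeroForm (v i) (v k) = -1 := by
      intro i j hij hij1 k hki hkj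
      refine (hvals i k (Ne.symm hki)).resolve_left fun h0 => ?_
      have hpar := mul_eq_mul_of_isotropic (hiso i) (hiso k) h0 h2
      obtain ⟨l, hl⟩ := Function.ne_iff.1 (hv0 i)
      rw [Pi.zero_apply] at hl
      have hval : v i l * traceZeroForm (v k) (v j) = v k l * traceZeroForm (v i) (v j) := by
        simp only [traceZeroForm]
        linear_combination (-2 * v j 0) * hpar l 0 - v j 2 * hpar l 1 - v j 1 * hpar l 2
      rw [hij1] at hval
      rcases hvals k j hkj with h | h
      · rw [h] at hval
        apply hv0 k
        ext m
        have hkl : v k l = 0 := by linear_combination hval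
        have := hpar l m
        rw [hkl, mul_zero] at this
        exact (mul_eq_zero.1 this).resolve_left hl
      · rw [h] at hval
        apply hki
        apply hinj
        ext m
        apply mul_left_cancel₀ hl
        rw [hpar]
        linear_combination v i m * hval
    have hik := key i j hij hij1 k hk.1 hk.2
    have hjk := key j i (Ne.symm hij) (by rw [traceZeroForm_comm]; exact hij1) k hk.2 hk.1
    have hg := gram_three (v i) (v j) (v k)
    rw [hiso, hiso, hiso, hij1, hjk, hik] at hg
    apply hsq
    refine ⟨(Matrix.of ![v i, v j, v k]).det, mul_left_cancel₀ h2 ?_⟩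
    linear_combination -hg

/-- Each coset of `PSL(2, F)` contributes at most `q` elements. -/
theorem card_le_two_mul_card_field [Finite F] {s : Finset PGL(2, F)} (h3 : (3 : F) = 0)
    (hsq : ¬ IsSquare (-1 : F)) (hs : ∀ f ∈ s, ∀ g ∈ s, f⁻¹ * g ∈ vertexFixing F) :
    s.card ≤ 2 * Nat.card F := by
  classical
  rw [← Finset.card_filter_add_card_filter_not (s := s) (· ∈ pslSubgroup F), two_mul]
  refine add_le_add (card_le_card_field h3 hsq fun f hf g hg => ?_)
    (card_le_card_field h3 hsq fun f hf g hg => ?_)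
  all_goals
    rw [Finset.mem_filter] at hf hg
    refine pow_three_of_mem_vertexFixing (hs f hf.1 g hg.1) ?_
  · exact mul_mem (inv_mem hf.2) hg.2
  · exact inv_mul_mem_pslSubgroup_of_not_mem hf.2 hg.2

/-- The class of the affine transformation `z ↦ a z + b`. -/
noncomputable def affine (a : Fˣ) (b : F) : PGL(2, F) :=
  proj !![(a : F), b; 0, 1] (by simp)

theorem affine_injective : Function.Injective fun x : Fˣ × F => affine x.1 x.2 := by
  rintro ⟨a, b⟩ ⟨a', b'⟩ h
  obtain ⟨u, -, hu⟩ := proj_eq_proj_iff.1 h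
  have h00 := congrFun (congrFun hu 0) 0
  have h01 := congrFun (congrFun hu 0) 1
  have h11 := congrFun (congrFun hu 1) 1
  simp at h00 h01 h11
  subst h11
  simp at h00 h01
  exact Prod.ext (Units.ext h00.symm) h01.symm

theorem affine_mem_vertexFixing_of_eq (h3 : (3 : F) = 0) (a : Fˣ) (b c : F) (ha : a ^ 2 = 1) :
    (affine a b)⁻¹ * affine a c ∈ vertexFixing F := by
  unfold affine
  rw [inv_mul_mem_vertexFixing_iff]
  right; left
  have ha' : (a : F) ^ 2 = 1 := by
    rw [← Units.val_pow_eq_pow_val, ha, Units.val_one]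
  simp [polar, Matrix.det_fin_two]
  linear_combination (a : F) ^ 2 * h3

theorem exists_card_eq_card_field [Finite F] (h3 : (3 : F) = 0) :
    ∃ s : Finset PGL(2, F), (∀ f ∈ s, f ∈ pslSubgroup F) ∧
      (∀ f ∈ s, ∀ g ∈ s, f⁻¹ * g ∈ vertexFixing F) ∧ s.card = Nat.card F := by
  classical
  have := Fintype.ofFinite F
  refine ⟨Finset.univ.image fun b : F => affine 1 b, ?_, ?_, ?_⟩
  · intro f hf
    obtain ⟨b, -, rfl⟩ := Finset.mem_image.1 hf
    unfold affine
    rw [proj_mem_pslSubgroup_iff]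
    exact ⟨1, by simp⟩
  · intro f hf g hg
    obtain ⟨b, -, rfl⟩ := Finset.mem_image.1 hf
    obtain ⟨c, -, rfl⟩ := Finset.mem_image.1 hg
    exact affine_mem_vertexFixing_of_eq h3 _ _ _ (by simp)
  · rw [Finset.card_image_of_injective _
      (fun b c h => (Prod.ext_iff.1 (@affine_injective F _ (1, b) (1, c) h)).2),
      Finset.card_univ, Nat.card_eq_fintype_card]

theorem exists_card_eq_two_mul_card_field [Finite F] (h3 : (3 : F) = 0)
    (hsq : ¬ IsSquare (-1 : F)) :
    ∃ s : Finset PGL(2, F), (∀ f ∈ s, ∀ g ∈ s, f⁻¹ * g ∈ vertexFixing F) ∧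
      s.card = 2 * Nat.card F := by
  classical
  have := Fintype.ofFinite F
  have h1 : (1 : Fˣ) ≠ -1 := by
    intro h
    have h' : (1 : F) = -1 := by simpa using congrArg Units.val h
    exact hsq ⟨1, by rw [← h', mul_one]⟩
  refine ⟨(({1, -1} : Finset Fˣ) ×ˢ Finset.univ).image fun x : Fˣ × F => affine x.1 x.2, ?_, ?_⟩
  · have hmix : ∀ b c : F, (affine 1 b)⁻¹ * affine (-1) c ∈ vertexFixing F := by
      intro b c
      unfold affine
      rw [inv_mul_mem_vertexFixing_iff]
      right; right
      simpa [polar] using hsq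
    have hmix' : ∀ b c : F, (affine (-1) b)⁻¹ * affine 1 c ∈ vertexFixing F := by
      intro b c
      unfold affine
      rw [inv_mul_mem_vertexFixing_iff]
      right; right
      simpa [polar] using hsq
    intro f hf g hg
    obtain ⟨⟨a, b⟩, hab, rfl⟩ := Finset.mem_image.1 hf
    obtain ⟨⟨a', b'⟩, hab', rfl⟩ := Finset.mem_image.1 hg
    simp at hab hab'
    rcases hab with rfl | rfl <;> rcases hab' with rfl | rfl
    · exact affine_mem_vertexFixing_of_eq h3 _ _ _ (by simp)
    · exact hmix _ _
    · exact hmix' _ _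
    · exact affine_mem_vertexFixing_of_eq h3 _ _ _ (by simp)
  · rw [Finset.card_image_of_injective _ affine_injective, Finset.card_product,
      Finset.card_pair h1, Finset.card_univ, Nat.card_eq_fintype_card]

end CharThree

/-! ### Vertex stabilizers -/

section VertexStabilizer

variable {V : Type*} {X : SimpleGraph V} {F : Type*} [Field F]

theorem isSArc_one {u v : V} (h : X.Adj u v) : IsSArc X 1 ![u, v] := by
  refine ⟨?_, fun i => ?_⟩
  · intro i j hij
    fin_cases i <;> fin_cases j <;> simp [h.ne, h.ne'] at hij ⊢
  · fin_cases i
    exact h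

theorem isSArc_two {u v w : V} (huv : X.Adj u v) (hvw : X.Adj v w) (huw : u ≠ w) :
    IsSArc X 2 ![u, v, w] := by
  refine ⟨?_, fun i => ?_⟩
  · intro i j hij
    fin_cases i <;> fin_cases j <;>
      simp [huv.ne, huv.ne', hvw.ne, hvw.ne', huw, huw.symm] at hij ⊢
  · fin_cases i
    · exact huv
    · exact hvw

theorem eq_one_of_arcRegular {P : Subgroup (X ≃g X)} (hP : IsSArcRegular 1 P) {g : X ≃g X}
    (hg : g ∈ P) {v x : V} (hvx : X.Adj v x) (hv : g v = v) (hx : g x = x) : g = 1 := by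
  refine (hP _ _ (isSArc_one hvx) (isSArc_one hvx)).unique ⟨hg, fun i => ?_⟩
    ⟨one_mem _, fun i => rfl⟩
  fin_cases i
  · exact hv
  · exact hx

theorem mem_map_pslSubgroup_iff (φ : PGL(2, F) ≃* (X ≃g X)) (g : PGL(2, F)) :
    φ g ∈ (pslSubgroup F).map φ.toMonoidHom ↔ g ∈ pslSubgroup F := by
  constructor
  · rintro ⟨h, hh, heq⟩
    rwa [← φ.injective heq]
  · exact fun h => ⟨g, h, rfl⟩

theorem exists_fixed_of_isConj {φ : PGL(2, F) ≃* (X ≃g X)} {g h : PGL(2, F)} (hgh : IsConj g h)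
    {v : V} (hv : φ g v = v) : ∃ w, φ h w = w := by
  obtain ⟨c, rfl⟩ := isConj_iff.1 hgh
  refine ⟨φ c v, ?_⟩
  have : φ (c * g * c⁻¹) (φ c v) = φ (c * g * c⁻¹ * c) v := by
    rw [map_mul φ (c * g * c⁻¹) c]; rfl
  rw [this, inv_mul_cancel_right, map_mul]
  exact congrArg (φ c) hv

variable [X.LocallyFinite]

theorem IsCubicOfTypeOneTwo.exists_neighbors (hX : IsCubicOfTypeOneTwo X) (v : V) :
    ∃ a b c : V, a ≠ b ∧ a ≠ c ∧ b ≠ c ∧ ∀ x, X.Adj v x ↔ x = a ∨ x = b ∨ x = c := by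
  classical
  obtain ⟨a, b, c, hab, hac, hbc, h⟩ := Finset.card_eq_three.1 (hX.cubic v)
  refine ⟨a, b, c, hab, hac, hbc, fun x => ?_⟩
  rw [← SimpleGraph.mem_neighborFinset, h]
  simp

/-- The vertex stabilizer acts faithfully on the neighbors, as two of them form a `2`-arc with the
vertex. -/
theorem IsCubicOfTypeOneTwo.eq_one (hX : IsCubicOfTypeOneTwo X) {g : X ≃g X} {u v w : V}
    (huv : X.Adj v u) (hvw : X.Adj v w) (huw : u ≠ w) (hu : g u = u) (hv : g v = v)
    (hw : g w = w) : g = 1 := by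
  have harc := isSArc_two huv.symm hvw huw
  refine (hX.twoArcRegular _ _ harc harc).unique ⟨Subgroup.mem_top _, fun i => ?_⟩
    ⟨Subgroup.mem_top _, fun i => rfl⟩
  fin_cases i
  · exact hu
  · exact hv
  · exact hw

/-- An automorphism fixing a vertex acts on its three neighbors with order dividing three, or as a
transposition. -/
theorem IsCubicOfTypeOneTwo.pow_eq_one (hX : IsCubicOfTypeOneTwo X) {g : X ≃g X} {v : V}
    (hv : g v = v) : g ^ 3 = 1 ∨ (g ^ 2 = 1 ∧ ∃ x, X.Adj v x ∧ g x = x) := by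
  obtain ⟨a, b, c, hab, hac, hbc, hN⟩ := hX.exists_neighbors v
  have hg : ∀ x, X.Adj v x → g x = a ∨ g x = b ∨ g x = c := by
    intro x hx
    rw [← hN]
    have := g.map_adj_iff.2 hx
    rwa [hv] at this
  have ha := (hN a).2 (by simp)
  have hb := (hN b).2 (by simp)
  have hc := (hN c).2 (by simp)
  have h2 : ∀ x, (g ^ 2) x = g (g x) := fun x => rfl
  have h3 : ∀ x, (g ^ 3) x = g (g (g x)) := fun x => rfl
  have iab : g a ≠ g b := g.injective.ne hab
  have iac : g a ≠ g c := g.injective.ne hac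
  have ibc : g b ≠ g c := g.injective.ne hbc
  rcases hg a ha with ga | ga | ga <;> rcases hg b hb with gb | gb | gb <;>
    rcases hg c hc with gc | gc | gc <;> simp only [ga, gb, gc, ne_eq, not_true] at iab iac ibc <;>
    first
    | (refine Or.inl (hX.eq_one ha hb hab ?_ ?_ ?_) <;> simp only [h3, ga, gb, gc, hv]; done)
    | (refine Or.inr ⟨hX.eq_one ha hb hab ?_ ?_ ?_, a, ha, ga⟩ <;>
        simp only [h2, ga, gb, gc, hv]; done)
    | (refine Or.inr ⟨hX.eq_one ha hb hab ?_ ?_ ?_, b, hb, gb⟩ <;>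
        simp only [h2, ga, gb, gc, hv]; done)
    | (refine Or.inr ⟨hX.eq_one ha hb hab ?_ ?_ ?_, c, hc, gc⟩ <;>
        simp only [h2, ga, gb, gc, hv]; done)

theorem mem_vertexFixing_of_fixed (hX : IsCubicOfTypeOneTwo X) (φ : PGL(2, F) ≃* (X ≃g X))
    (hG : IsSArcRegular 1 ((pslSubgroup F).map φ.toMonoidHom)) {g : PGL(2, F)} {v : V}
    (hv : φ g v = v) : g ∈ vertexFixing F := by
  rcases hX.pow_eq_one hv with h | ⟨h, x, hx, hgx⟩
  · left
    rwa [← map_pow, EmbeddingLike.map_eq_one_iff] at h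
  · by_cases hg : g ∈ pslSubgroup F
    · left
      have := eq_one_of_arcRegular hG ((mem_map_pslSubgroup_iff φ g).2 hg) hx hv hgx
      rw [EmbeddingLike.map_eq_one_iff] at this
      rw [this, one_pow]
    · right
      rw [← map_pow, EmbeddingLike.map_eq_one_iff] at h
      exact ⟨h, hg⟩

theorem exists_pow_three_fixed (hX : IsCubicOfTypeOneTwo X) (φ : PGL(2, F) ≃* (X ≃g X))
    (hG : IsSArcRegular 1 ((pslSubgroup F).map φ.toMonoidHom)) (v : V) :
    ∃ t : PGL(2, F), t ^ 3 = 1 ∧ t ≠ 1 ∧ φ t v = v := by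
  obtain ⟨a, b, c, hab, hac, hbc, hN⟩ := hX.exists_neighbors v
  obtain ⟨g, ⟨⟨t, ht, rfl⟩, hg⟩, -⟩ := hG _ _ (isSArc_one ((hN a).2 (by simp)))
    (isSArc_one ((hN b).2 (by simp)))
  have hv : φ t v = v := hg 0
  have ha : φ t a = b := hg 1
  refine ⟨t, pow_three_of_mem_vertexFixing (mem_vertexFixing_of_fixed hX φ hG hv) ht, ?_, hv⟩
  rintro rfl
  rw [map_one] at ha
  exact hab ha

theorem exists_sq_fixed (hX : IsCubicOfTypeOneTwo X) (φ : PGL(2, F) ≃* (X ≃g X))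
    (hG : IsSArcRegular 1 ((pslSubgroup F).map φ.toMonoidHom)) (v : V) :
    ∃ s : PGL(2, F), s ^ 2 = 1 ∧ s ∉ pslSubgroup F ∧ φ s v = v := by
  obtain ⟨a, b, c, hab, hac, hbc, hN⟩ := hX.exists_neighbors v
  have ha := (hN a).2 (by simp)
  have hb := (hN b).2 (by simp)
  obtain ⟨g, ⟨-, hg⟩, -⟩ := hX.twoArcRegular _ _ (isSArc_two ha.symm hb hab)
    (isSArc_two hb.symm ha hab.symm)
  obtain ⟨s, rfl⟩ := φ.surjective g
  have ga : φ s a = b := hg 0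
  have gv : φ s v = v := hg 1
  have gb : φ s b = a := hg 2
  have hs : s ∉ pslSubgroup F := by
    intro hs
    have h3 := pow_three_of_mem_vertexFixing (mem_vertexFixing_of_fixed hX φ hG gv) hs
    have h3' : (φ s ^ 3) a = a := by rw [← map_pow, h3, map_one]; rfl
    have : (φ s ^ 3) a = φ s (φ s (φ s a)) := rfl
    rw [this, ga, gb, ga] at h3'
    exact hab h3'.symm
  refine ⟨s, ?_, hs, gv⟩
  exact ((mem_vertexFixing_of_fixed hX φ hG gv).resolve_left
    fun h => hs (mem_pslSubgroup_of_pow_three h)).1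

/-- The vertex stabilizers are symmetric groups of degree three, meeting `PSL(2, F)` in a group of
order three. By the conjugacy of the elements of order three, and of the involutions outside
`PSL(2, F)`, this determines the elements that fix a vertex. -/
theorem exists_fixed_vertex_iff [Finite F] [Nonempty V] (hX : IsCubicOfTypeOneTwo X)
    (φ : PGL(2, F) ≃* (X ≃g X)) (hG : IsSArcRegular 1 ((pslSubgroup F).map φ.toMonoidHom))
    (g : PGL(2, F)) : (∃ v, φ g v = v) ↔ g ∈ vertexFixing F := by
  refine ⟨fun ⟨v, hv⟩ => mem_vertexFixing_of_fixed hX φ hG hv, ?_⟩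
  obtain ⟨v⟩ := ‹Nonempty V›
  rintro (h | ⟨h, hg⟩)
  · by_cases hg1 : g = 1
    · exact ⟨v, by rw [hg1, map_one]; rfl⟩
    · obtain ⟨t, ht, ht1, htv⟩ := exists_pow_three_fixed hX φ hG v
      exact exists_fixed_of_isConj (isConj_of_pow_three ht ht1 h hg1) htv
  · obtain ⟨s, hs, hs1, hsv⟩ := exists_sq_fixed hX φ hG v
    exact exists_fixed_of_isConj (isConj_of_sq hs hs1 h hg) hsv

theorem index_pslSubgroup [Finite F] {s : PGL(2, F)} (hs : s ∉ pslSubgroup F) :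
    (pslSubgroup F).index = 2 := by
  rw [Subgroup.index_eq_two_iff]
  refine ⟨s, fun b => ?_⟩
  by_cases hb : b ∈ pslSubgroup F
  · refine Or.inr ⟨hb, fun h => hs ?_⟩
    simpa using mul_mem (inv_mem hb) h
  · exact Or.inl ⟨mul_mem_pslSubgroup_of_not_mem hb hs, hb⟩

/-- In characteristic three an involution that inverts a unipotent element is represented by an
upper triangular matrix with opposite diagonal entries, so that it can lie outside `PSL(2, F)`
only if `-1` is not a square. -/
theorem not_isSquare_neg_one [Finite F] [Nonempty V] (h3 : (3 : F) = 0)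
    (hX : IsCubicOfTypeOneTwo X) (φ : PGL(2, F) ≃* (X ≃g X))
    (hG : IsSArcRegular 1 ((pslSubgroup F).map φ.toMonoidHom)) : ¬ IsSquare (-1 : F) := by
  obtain ⟨v⟩ := ‹Nonempty V›
  obtain ⟨t, ht, ht1, htv⟩ := exists_pow_three_fixed hX φ hG v
  obtain ⟨s, hs, hs1, hsv⟩ := exists_sq_fixed hX φ hG v
  have hstpsl : s * t ∉ pslSubgroup F := fun h =>
    hs1 (by simpa using mul_mem h (inv_mem (mem_pslSubgroup_of_pow_three ht)))
  have hst : (s * t) ^ 2 = 1 := by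
    have hfix : φ (s * t) v = v := by
      rw [map_mul]
      exact (congrArg (φ s) htv).trans hsv
    exact ((mem_vertexFixing_of_fixed hX φ hG hfix).resolve_left
      fun h => hstpsl (mem_pslSubgroup_of_pow_three h)).1
  have hnormal : (pslSubgroup F).Normal := Subgroup.normal_of_index_eq_two (index_pslSubgroup hs1)
  have hu1 : (affine 1 1 : PGL(2, F)) ≠ 1 := by
    unfold affine
    rw [Ne, proj_eq_one_iff]
    simp
  have hu : (affine 1 1 : PGL(2, F)) ^ 3 = 1 := by
    unfold affine
    rw [proj_pow_three_eq_one_iff]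
    right
    simp [Matrix.trace_fin_two]
    linear_combination h3
  obtain ⟨c, hc⟩ := isConj_iff.1 (isConj_of_pow_three ht ht1 hu hu1)
  have hs' : (c * s * c⁻¹) ^ 2 = 1 := by
    rw [conj_pow, hs]; simp
  have hs1' : c * s * c⁻¹ ∉ pslSubgroup F := fun h => hs1 (by
    simpa [mul_assoc] using hnormal.conj_mem _ h c⁻¹)
  have hst' : (c * s * c⁻¹ * affine 1 1) ^ 2 = 1 := by
    rw [← hc, show c * s * c⁻¹ * (c * t * c⁻¹) = c * (s * t) * c⁻¹ by group, conj_pow, hst]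
    simp
  have hstpsl' : c * s * c⁻¹ * affine 1 1 ∉ pslSubgroup F := by
    rw [← hc, show c * s * c⁻¹ * (c * t * c⁻¹) = c * (s * t) * c⁻¹ by group]
    exact fun h => hstpsl (by simpa [mul_assoc] using hnormal.conj_mem _ h c⁻¹)
  obtain ⟨S, hS, hSs⟩ := exists_eq_proj (c * s * c⁻¹)
  rw [hSs] at hs' hs1' hst' hstpsl'
  have htr := (proj_sq_eq_one_iff.1 hs').resolve_left fun h => hs1' (h ▸ one_mem _)
  unfold affine at hst' hstpsl'
  rw [proj_mul] at hst' hstpsl'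
  have htr' := (proj_sq_eq_one_iff.1 hst').resolve_left fun h => hstpsl' (h ▸ one_mem _)
  rw [Matrix.trace_fin_two] at htr htr'
  simp [Matrix.mul_apply, Fin.sum_univ_two] at htr'
  rintro ⟨i, hi⟩
  apply hs1'
  rw [proj_mem_pslSubgroup_iff, Matrix.det_fin_two]
  refine ⟨i * S 0 0, ?_⟩
  have h10 : S 1 0 = 0 := by linear_combination htr' - htr
  rw [h10]
  linear_combination S 0 0 * htr + S 0 0 ^ 2 * hi

end VertexStabilizer

/-! ### Arc-transitive groups and their densities -/

section ArcTransitiveGroups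

variable {V : Type*} {X : SimpleGraph V}

/-- Arcs as darts. -/
def dartEquivArc (X : SimpleGraph V) : X.Dart ≃ {a : Fin 2 → V // IsSArc X 1 a} where
  toFun d := ⟨![d.fst, d.snd], isSArc_one d.adj⟩
  invFun a := ⟨(a.1 0, a.1 1), a.2.2 0⟩
  left_inv d := rfl
  right_inv a := by
    ext i
    fin_cases i <;> rfl

theorem card_arcs [Finite V] [X.LocallyFinite] (hX : X.IsRegularOfDegree 3) :
    Nat.card {a : Fin 2 → V // IsSArc X 1 a} = 3 * Nat.card V := by
  classical
  have := Fintype.ofFinite V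
  rw [← Nat.card_congr (dartEquivArc X), Nat.card_eq_fintype_card,
    SimpleGraph.dart_card_eq_sum_degrees, Nat.card_eq_fintype_card]
  rw [Finset.sum_congr rfl (g := fun _ => 3) fun v _ => by convert hX.degree_eq v]
  simp [mul_comm]

theorem isSArc_comp (g : X ≃g X) {s : ℕ} {a : Fin (s + 1) → V} (ha : IsSArc X s a) :
    IsSArc X s (g ∘ a) :=
  ⟨g.injective.comp ha.1, fun i => g.map_adj_iff.2 (ha.2 i)⟩

theorem card_arcs_le [Finite V] {H : Subgroup (X ≃g X)} (hH : IsSArcTransitive 1 H) {a : Fin 2 → V}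
    (ha : IsSArc X 1 a) : Nat.card {a : Fin 2 → V // IsSArc X 1 a} ≤ Nat.card H := by
  refine Nat.card_le_card_of_surjective (fun h : H => ⟨h.1 ∘ a, isSArc_comp h.1 ha⟩) ?_
  rintro ⟨b, hb⟩
  obtain ⟨g, hg, hgb⟩ := hH a b ha hb
  exact ⟨⟨g, hg⟩, Subtype.ext (funext hgb)⟩

theorem card_of_arcRegular {P : Subgroup (X ≃g X)} (hP : IsSArcRegular 1 P) {a : Fin 2 → V}
    (ha : IsSArc X 1 a) : Nat.card P = Nat.card {a : Fin 2 → V // IsSArc X 1 a} := by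
  refine Nat.card_eq_of_bijective (fun h : P => ⟨h.1 ∘ a, isSArc_comp h.1 ha⟩) ⟨?_, ?_⟩
  · intro g h hgh
    have hgh' : g.1 ∘ a = h.1 ∘ a := congrArg Subtype.val hgh
    exact Subtype.ext ((hP a (g.1 ∘ a) ha (isSArc_comp _ ha)).unique ⟨g.2, fun i => rfl⟩
      ⟨h.2, fun i => (congrFun hgh' i).symm⟩)
  · rintro ⟨b, hb⟩
    obtain ⟨g, ⟨hg, hgb⟩, -⟩ := hP a b ha hb
    exact ⟨⟨g, hg⟩, Subtype.ext (funext hgb)⟩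

variable {F : Type*} [Field F]

/-- The square of every element lies in a subgroup of index two, hence so do the transvections,
which generate `PSL(2, F)`. -/
theorem pslSubgroup_le_of_sq_mem (h2 : (2 : F) ≠ 0) {K : Subgroup PGL(2, F)}
    (hK : ∀ g : PGL(2, F), g ^ 2 ∈ K) : pslSubgroup F ≤ K := by
  have hU : ∀ b : F, proj !![1, b; 0, 1] (by simp) ∈ K := by
    intro b
    have := hK (proj !![1, b / 2; 0, 1] (by simp))
    rw [sq, proj_mul] at this
    convert this using 2
    ext i j
    fin_cases i <;> fin_cases j <;> simp [Matrix.mul_apply, Fin.sum_univ_two]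
    field_simp
    ring
  have hL : ∀ c : F, proj !![1, 0; c, 1] (by simp) ∈ K := by
    intro c
    have := hK (proj !![1, 0; c / 2, 1] (by simp))
    rw [sq, proj_mul] at this
    convert this using 2
    ext i j
    fin_cases i <;> fin_cases j <;> simp [Matrix.mul_apply, Fin.sum_univ_two]
    field_simp
    ring
  have main : ∀ (A : Matrix (Fin 2) (Fin 2) F) (hA : A.det ≠ 0), A.det = 1 → A 1 0 ≠ 0 →
      proj A hA ∈ K := by
    intro A hA hdet hc
    have := mul_mem (mul_mem (hU ((A 0 0 - 1) / A 1 0)) (hL (A 1 0))) (hU ((A 1 1 - 1) / A 1 0))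
    rw [proj_mul, proj_mul] at this
    convert this using 2
    rw [Matrix.det_fin_two] at hdet
    ext i j
    fin_cases i <;> fin_cases j <;> simp [Matrix.mul_apply, Fin.sum_univ_two] <;> field_simp
    all_goals first | linear_combination -hdet | ring1
  intro g hg
  obtain ⟨A, hA, hdet, rfl⟩ := exists_det_eq_one hg
  by_cases hc : A 1 0 = 0
  · have hL1 : (!![1, 0; 1, 1] : Matrix (Fin 2) (Fin 2) F).det ≠ 0 := by simp
    have h00 : A 0 0 ≠ 0 := by
      rintro h0
      rw [Matrix.det_fin_two, h0, hc] at hdet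
      simp at hdet
    have h := main (!![1, 0; 1, 1] * A) (by rw [Matrix.det_mul]; exact mul_ne_zero hL1 hA)
      (by rw [Matrix.det_mul, hdet]; simp)
      (by simpa [Matrix.mul_apply, Fin.sum_univ_two, hc] using h00)
    rw [← proj_mul hL1 hA] at h
    exact (Subgroup.mul_mem_cancel_left K (hL 1)).1 h
  · exact main A hA hdet hc

theorem card_pgl [Finite F] {s : PGL(2, F)} (hs : s ∉ pslSubgroup F) :
    Nat.card PGL(2, F) = 2 * Nat.card (pslSubgroup F) := by
  rw [← Subgroup.card_mul_index (pslSubgroup F), index_pslSubgroup hs, mul_comm]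

/-- A subgroup containing at least half of the elements is the whole group or `PSL(2, F)`. -/
theorem eq_top_or_eq_pslSubgroup [Finite F] (h2 : (2 : F) ≠ 0) {s : PGL(2, F)}
    (hs : s ∉ pslSubgroup F) {K : Subgroup PGL(2, F)}
    (hK : Nat.card (pslSubgroup F) ≤ Nat.card K) : K = ⊤ ∨ K = pslSubgroup F := by
  have hfin : Finite PGL(2, F) := Finite.of_surjective _ Matrix.ProjGenLinGroup.mk_surjective
  have h := Subgroup.card_mul_index K
  rw [card_pgl hs] at h
  have hpos : 0 < Nat.card (pslSubgroup F) := Nat.card_pos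
  have hi : K.index ≤ 2 := by
    by_contra! hi
    have := Nat.mul_le_mul hK hi
    omega
  have hi0 : K.index ≠ 0 := Subgroup.index_ne_zero_of_finite
  rcases (by omega : K.index = 1 ∨ K.index = 2) with h1 | h1
  · exact Or.inl (Subgroup.index_eq_one.1 h1)
  · right
    have hle := pslSubgroup_le_of_sq_mem h2 fun g => Subgroup.sq_mem_of_index_two h1 g
    rw [h1] at h
    exact (Subgroup.eq_of_le_of_card_ge hle (by omega)).symm

/-- `IsMaxIntersecting K n` states that `n` is the largest size of a subset of `K` all of whose
quotients lie in `vertexFixing F`. -/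
def IsMaxIntersecting (K : Subgroup PGL(2, F)) (n : ℕ) : Prop :=
  IsGreatest {m | ∃ s : Finset PGL(2, F), (∀ f ∈ s, f ∈ K) ∧
    (∀ f ∈ s, ∀ g ∈ s, f⁻¹ * g ∈ vertexFixing F) ∧ s.card = m} n

variable [X.LocallyFinite]

/-- Intersecting sets in the image of `K` correspond to subsets of `K` with quotients in
`vertexFixing F`. -/
theorem density_map [Finite F] [Nonempty V] (hX : IsCubicOfTypeOneTwo X)
    (φ : PGL(2, F) ≃* (X ≃g X)) (hG : IsSArcRegular 1 ((pslSubgroup F).map φ.toMonoidHom))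
    {K : Subgroup PGL(2, F)} {n : ℕ} (hn : IsMaxIntersecting K n) :
    density (K.map φ.toMonoidHom) V = n / ((Nat.card K : ℚ) / (Nat.card V : ℚ)) := by
  classical
  have hfix : ∀ f g : PGL(2, F), (∃ v : V, φ f v = φ g v) ↔ f⁻¹ * g ∈ vertexFixing F := by
    intro f g
    rw [← exists_fixed_vertex_iff hX φ hG]
    refine exists_congr fun v => ?_
    have h1 : φ f (φ (f⁻¹ * g) v) = φ g v := by
      have : φ f (φ (f⁻¹ * g) v) = (φ f * φ (f⁻¹ * g)) v := rfl
      rw [this, ← map_mul, mul_inv_cancel_left]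
    rw [← h1]
    exact ⟨fun h => ((φ f).injective h).symm, fun h => by rw [h]⟩
  have hsup : IsGreatest {m : ℕ | ∃ s : Finset (K.map φ.toMonoidHom),
      IsIntersecting V (s : Set (K.map φ.toMonoidHom)) ∧ s.card = m} n := by
    constructor
    · obtain ⟨s, hsK, hs, rfl⟩ := hn.1
      refine ⟨s.attach.image fun f => ⟨φ f.1, f.1, hsK _ f.2, rfl⟩, ?_, ?_⟩
      · intro f hf g hg
        rw [Finset.mem_coe, Finset.mem_image] at hf hg
        obtain ⟨f', -, rfl⟩ := hf
        obtain ⟨g', -, rfl⟩ := hg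
        exact (hfix f'.1 g'.1).2 (hs _ f'.2 _ g'.2)
      · rw [Finset.card_image_of_injective, Finset.card_attach]
        intro f g hfg
        exact Subtype.ext (φ.injective (congrArg Subtype.val hfg))
    · rintro m ⟨s, hs, rfl⟩
      refine hn.2 ⟨s.image fun f => φ.symm f.1, ?_, ?_, ?_⟩
      · intro f hf
        obtain ⟨⟨_, f', hf', rfl⟩, -, rfl⟩ := Finset.mem_image.1 hf
        simpa using hf'
      · intro f hf g hg
        obtain ⟨f', hf', rfl⟩ := Finset.mem_image.1 hf
        obtain ⟨g', hg', rfl⟩ := Finset.mem_image.1 hg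
        rw [← hfix]
        rw [MulEquiv.apply_symm_apply, MulEquiv.apply_symm_apply]
        exact hs f' hf' g' hg'
      · rw [Finset.card_image_of_injective]
        intro f g hfg
        exact Subtype.ext (φ.symm.injective hfg)
  have hcard : Nat.card (K.map φ.toMonoidHom) = Nat.card K :=
    (Nat.card_congr (K.equivMapOfInjective φ.toMonoidHom φ.injective).toEquiv).symm
  unfold density
  rw [hsup.csSup_eq, hcard]

/-- The elements of `K` with a given image of a vertex form an intersecting set, and some image is
taken by at least `|K| / |V|` of them. -/
theorem exists_intersecting_of_card_eq [Finite F] [Finite V] [Nonempty V]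
    (hX : IsCubicOfTypeOneTwo X) (φ : PGL(2, F) ≃* (X ≃g X))
    (hG : IsSArcRegular 1 ((pslSubgroup F).map φ.toMonoidHom)) {K : Subgroup PGL(2, F)} {m : ℕ}
    (hK : Nat.card K = m * Nat.card V) :
    ∃ s : Finset PGL(2, F), (∀ f ∈ s, f ∈ K) ∧
      (∀ f ∈ s, ∀ g ∈ s, f⁻¹ * g ∈ vertexFixing F) ∧ m ≤ s.card := by
  classical
  have hfin : Finite PGL(2, F) := Finite.of_surjective _ Matrix.ProjGenLinGroup.mk_surjective
  have := Fintype.ofFinite PGL(2, F)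
  have := Fintype.ofFinite V
  obtain ⟨v⟩ := ‹Nonempty V›
  obtain ⟨w, -, hw⟩ := Finset.exists_le_card_fiber_of_mul_le_card_of_maps_to
    (s := Finset.univ.filter (· ∈ K)) (t := (Finset.univ : Finset V)) (f := fun g => φ g v)
    (n := m) (fun _ _ => Finset.mem_univ _) ⟨v, Finset.mem_univ _⟩ (by
      rw [Finset.card_univ, ← Nat.card_eq_fintype_card, mul_comm, ← hK, Nat.card_eq_fintype_card,
        Fintype.card_subtype])
  refine ⟨_, ?_, ?_, hw⟩
  · intro f hf
    simp at hf
    exact hf.1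
  · intro f hf g hg
    simp at hf hg
    refine mem_vertexFixing_of_fixed hX φ hG (v := v) ?_
    rw [map_mul, map_inv]
    exact (Equiv.symm_apply_eq (φ f).toEquiv).2 (hg.2.trans hf.2.symm)

end ArcTransitiveGroups

/-! ### The weak intersection density array -/

section WeakArray

variable {V : Type*} {X : SimpleGraph V} {F : Type*} [Field F]

theorem nonempty_of_mulEquiv (φ : PGL(2, F) ≃* (X ≃g X)) : Nonempty V := by
  by_contra h
  rw [not_nonempty_iff] at h
  have hsub : φ (affine 1 1) = φ 1 := by ext v; exact h.elim v
  have := φ.injective hsub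
  unfold affine at this
  rw [proj_eq_one_iff] at this
  simp at this

theorem weakDensityArray_eq_of_mem_iff [Finite V] {l : List ℚ} (hl : l.Pairwise (· < ·))
    (h : ∀ r, r ∈ weakDensityArray X ↔ r ∈ l) : weakDensityArray X = l := by
  have hle : (weakDensityArray X).Pairwise (· ≤ ·) :=
    List.Pairwise.filter _ (Finset.pairwise_sort _ _)
  have hnodup : (weakDensityArray X).Nodup := List.Nodup.filter _ (Finset.sort_nodup _ _)
  refine List.Perm.eq_of_pairwise' hle (hl.imp le_of_lt) ?_
  exact (List.perm_ext_iff_of_nodup hnodup (hl.imp ne_of_lt)).2 h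

variable [X.LocallyFinite]

theorem IsSArcTransitive.isPretransitive (hX : IsCubicOfTypeOneTwo X) {H : Subgroup (X ≃g X)}
    (hH : IsSArcTransitive 1 H) : MulAction.IsPretransitive H V := by
  refine ⟨fun v w => ?_⟩
  obtain ⟨a, _, _, _, _, _, ha⟩ := hX.exists_neighbors v
  obtain ⟨b, _, _, _, _, _, hb⟩ := hX.exists_neighbors w
  obtain ⟨g, hg, h⟩ := hH _ _ (isSArc_one ((ha a).2 (Or.inl rfl)))
    (isSArc_one ((hb b).2 (Or.inl rfl)))
  exact ⟨⟨g, hg⟩, h 0⟩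

theorem mem_weakDensityArray_iff [Finite V] (hX : IsCubicOfTypeOneTwo X) {r : ℚ} :
    r ∈ weakDensityArray X ↔ ∃ H : Subgroup (X ≃g X), IsSArcTransitive 1 H ∧ density H V = r := by
  unfold weakDensityArray densityArray
  simp only [List.mem_filter, Finset.mem_sort, Set.Finite.mem_toFinset, decide_eq_true_eq]
  refine ⟨fun h => h.2, fun h => ⟨?_, h⟩⟩
  obtain ⟨H, hH, hr⟩ := h
  exact ⟨H, hH.isPretransitive hX, hr⟩

theorem card_pslSubgroup [Finite V] (hX : IsCubicOfTypeOneTwo X) (φ : PGL(2, F) ≃* (X ≃g X))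
    (hG : IsSArcRegular 1 ((pslSubgroup F).map φ.toMonoidHom)) :
    Nat.card (pslSubgroup F) = 3 * Nat.card V := by
  obtain ⟨v⟩ := nonempty_of_mulEquiv φ
  obtain ⟨a, _, _, _, _, _, ha⟩ := hX.exists_neighbors v
  rw [← card_arcs hX.cubic, ← card_of_arcRegular hG (isSArc_one ((ha a).2 (Or.inl rfl)))]
  exact Nat.card_congr ((pslSubgroup F).equivMapOfInjective φ.toMonoidHom φ.injective).toEquiv

theorem card_top_pgl [Finite V] [Finite F] (hX : IsCubicOfTypeOneTwo X)
    (φ : PGL(2, F) ≃* (X ≃g X)) (hG : IsSArcRegular 1 ((pslSubgroup F).map φ.toMonoidHom)) :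
    Nat.card (⊤ : Subgroup PGL(2, F)) = 6 * Nat.card V := by
  obtain ⟨v⟩ := nonempty_of_mulEquiv φ
  obtain ⟨s, -, hs, -⟩ := exists_sq_fixed hX φ hG v
  rw [Subgroup.card_top, card_pgl hs, card_pslSubgroup hX φ hG]
  ring

/-- The arc-transitive groups of automorphisms are the images of `PGL(2, F)` and `PSL(2, F)`. -/
theorem isSArcTransitive_iff [Finite V] [Finite F] (h2 : (2 : F) ≠ 0)
    (hX : IsCubicOfTypeOneTwo X) (φ : PGL(2, F) ≃* (X ≃g X))
    (hG : IsSArcRegular 1 ((pslSubgroup F).map φ.toMonoidHom)) {H : Subgroup (X ≃g X)} :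
    IsSArcTransitive 1 H ↔ H = (⊤ : Subgroup PGL(2, F)).map φ.toMonoidHom ∨
      H = (pslSubgroup F).map φ.toMonoidHom := by
  have htop : (⊤ : Subgroup PGL(2, F)).map φ.toMonoidHom = ⊤ :=
    Subgroup.map_top_of_surjective _ φ.surjective
  constructor
  · intro hH
    obtain ⟨v⟩ := nonempty_of_mulEquiv φ
    obtain ⟨a, _, _, _, _, _, ha⟩ := hX.exists_neighbors v
    obtain ⟨s, -, hs, -⟩ := exists_sq_fixed hX φ hG v
    have hmap : (H.comap φ.toMonoidHom).map φ.toMonoidHom = H :=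
      Subgroup.map_comap_eq_self_of_surjective φ.surjective H
    have hcard : Nat.card (pslSubgroup F) ≤ Nat.card (H.comap φ.toMonoidHom) := by
      have h1 := card_arcs_le hH (isSArc_one ((ha a).2 (Or.inl rfl)))
      rw [card_arcs hX.cubic, ← card_pslSubgroup hX φ hG] at h1
      refine h1.trans (le_of_eq ?_)
      rw [Nat.card_congr ((H.comap φ.toMonoidHom).equivMapOfInjective φ.toMonoidHom
        φ.injective).toEquiv, hmap]
    rcases eq_top_or_eq_pslSubgroup h2 hs hcard with h | h
    · left; rw [← h, hmap]
    · right; rw [← h, hmap]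
  · rintro (rfl | rfl)
    · rw [htop]
      exact hX.arcTransitive
    · intro a b ha hb
      exact (hG a b ha hb).exists

theorem weakDensityArray_eq [Finite V] [Finite F] (h2 : (2 : F) ≠ 0)
    (hX : IsCubicOfTypeOneTwo X) (φ : PGL(2, F) ≃* (X ≃g X))
    (hG : IsSArcRegular 1 ((pslSubgroup F).map φ.toMonoidHom)) {m n : ℕ}
    (hm : IsMaxIntersecting (⊤ : Subgroup PGL(2, F)) m)
    (hn : IsMaxIntersecting (pslSubgroup F) n) {l : List ℚ} (hl : l.Pairwise (· < ·))
    (h : ∀ r, r ∈ l ↔ r = m / 6 ∨ r = n / 3) : weakDensityArray X = l := by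
  refine weakDensityArray_eq_of_mem_iff hl fun r => ?_
  have hV := nonempty_of_mulEquiv φ
  have hV0 : (Nat.card V : ℚ) ≠ 0 := by exact_mod_cast Nat.card_pos.ne'
  have dtop := density_map hX φ hG hm
  have dpsl := density_map hX φ hG hn
  rw [card_top_pgl hX φ hG, Nat.cast_mul, mul_div_cancel_right₀ _ hV0, Nat.cast_ofNat] at dtop
  rw [card_pslSubgroup hX φ hG, Nat.cast_mul, mul_div_cancel_right₀ _ hV0, Nat.cast_ofNat] at dpsl
  rw [mem_weakDensityArray_iff hX, h, ← dtop, ← dpsl]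
  simp only [isSArcTransitive_iff h2 hX φ hG]
  constructor
  · rintro ⟨H, rfl | rfl, rfl⟩
    · exact Or.inl rfl
    · exact Or.inr rfl
  · rintro (rfl | rfl)
    · exact ⟨_, Or.inl rfl, rfl⟩
    · exact ⟨_, Or.inr rfl, rfl⟩

end WeakArray

/-! ### Extremal sizes -/

section MaxIntersecting

variable {F : Type*} [Field F]

theorem IsMaxIntersecting.of_card_eq {K : Subgroup PGL(2, F)} {n : ℕ}
    (h : ∃ s : Finset PGL(2, F), (∀ f ∈ s, f ∈ K) ∧
      (∀ f ∈ s, ∀ g ∈ s, f⁻¹ * g ∈ vertexFixing F) ∧ n ≤ s.card)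
    (h' : ∀ s : Finset PGL(2, F), (∀ f ∈ s, f ∈ K) →
      (∀ f ∈ s, ∀ g ∈ s, f⁻¹ * g ∈ vertexFixing F) → s.card ≤ n) : IsMaxIntersecting K n := by
  obtain ⟨s, hsK, hs, hcard⟩ := h
  refine ⟨⟨s, hsK, hs, le_antisymm (h' s hsK hs) hcard⟩, ?_⟩
  rintro m ⟨t, htK, ht, rfl⟩
  exact h' t htK ht

theorem isMaxIntersecting_psl {n : ℕ}
    (h : ∃ s : Finset PGL(2, F), (∀ f ∈ s, f ∈ pslSubgroup F) ∧
      (∀ f ∈ s, ∀ g ∈ s, f⁻¹ * g ∈ vertexFixing F) ∧ n ≤ s.card)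
    (h' : ∀ s : Finset PGL(2, F), (∀ f ∈ s, ∀ g ∈ s, (f⁻¹ * g) ^ 3 = 1) → s.card ≤ n) :
    IsMaxIntersecting (pslSubgroup F) n :=
  IsMaxIntersecting.of_card_eq h fun s hsK hs => h' s fun f hf g hg =>
    pow_three_of_mem_vertexFixing (hs f hf g hg) (mul_mem (inv_mem (hsK f hf)) (hsK g hg))

end MaxIntersecting

/-! ### Cube roots of unity and square roots in finite fields -/

section FiniteFieldSquares

variable {F : Type*} [Field F] [Finite F]

theorem exists_cube_root (hF : Nat.card F ≡ 1 [MOD 3]) : ∃ ω : F, ω ^ 2 + ω + 1 = 0 := by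
  have := Fintype.ofFinite F
  have hdvd : 3 ∣ Nat.card Fˣ := by
    rw [Nat.card_units]
    exact (Nat.modEq_iff_dvd' Nat.card_pos).1 hF.symm
  obtain ⟨ω, hω⟩ := exists_prime_orderOf_dvd_card' 3 hdvd
  refine ⟨ω, ?_⟩
  have h1 : (ω : F) - 1 ≠ 0 := by
    intro h
    have : ω = 1 := Units.ext (sub_eq_zero.1 h)
    rw [this, orderOf_one] at hω
    omega
  have h3 : (ω : F) ^ 3 = 1 := by
    rw [← Units.val_pow_eq_pow_val, ← hω, pow_orderOf_eq_one, Units.val_one]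
  exact (mul_eq_zero.1 (by linear_combination h3 :
    ((ω : F) - 1) * ((ω : F) ^ 2 + ω + 1) = 0)).resolve_left h1

theorem not_isSquare_neg_three (h2 : (2 : F) ≠ 0) (h3 : (3 : F) ≠ 0)
    (hF : Nat.card F ≡ 2 [MOD 3]) : ¬ IsSquare (-3 : F) := by
  rintro ⟨r, hr⟩
  set ω : F := (r - 1) / 2 with hω
  have hω2 : ω ^ 2 + ω + 1 = 0 := by
    rw [hω]; field_simp; linear_combination -hr
  have hω3 : ω ^ 3 = 1 := by linear_combination (ω - 1) * hω2
  have hω0 : ω ≠ 0 := by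
    intro h; rw [h] at hω2; simp at hω2
  have hω1 : ω ≠ 1 := by
    intro h; rw [h] at hω2; apply h3; linear_combination hω2
  have hord : orderOf (Units.mk0 ω hω0) = 3 := by
    refine orderOf_eq_prime (Units.ext (by simpa using hω3)) fun h => hω1 ?_
    simpa using congrArg Units.val h
  have hdvd := orderOf_dvd_natCard (Units.mk0 ω hω0)
  rw [hord, Nat.card_units] at hdvd
  have hpos : 0 < Nat.card F := Nat.card_pos
  unfold Nat.ModEq at hF
  omega

theorem quadraticChar_zmod_five_ne_neg_one_iff : have := Fact.mk Nat.prime_five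
    ∀ c : ZMod 5, (quadraticChar (ZMod 5) c ≠ -1 ↔ c = 0 ∨ c = 1 ∨ c = 4) ∧
      (quadraticChar (ZMod 5) (-c) ≠ -1 ↔ c = 0 ∨ c = 1 ∨ c = 4) := by
  decide

/-- Quadratic reciprocity, for a finite field that need not be a prime field. -/
theorem isSquare_five_iff (h2 : (2 : F) ≠ 0) :
    IsSquare (5 : F) ↔ Nat.card F ≡ 0 [MOD 5] ∨ Nat.card F ≡ 1 [MOD 5] ∨
      Nat.card F ≡ 4 [MOD 5] := by
  have := Fintype.ofFinite F
  have := Fact.mk Nat.prime_five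
  have hchar : ringChar F ≠ 2 := fun h => h2 (by
    have := ringChar.of_eq h
    exact_mod_cast CharP.cast_eq_zero F 2)
  have hodd := FiniteField.odd_card_of_char_ne_two hchar
  have h := FiniteField.isSquare_odd_prime_iff hchar (p := 5) (by norm_num)
  rw [Nat.cast_ofNat] at h
  rw [h, Nat.card_eq_fintype_card]
  have hχ : ZMod.χ₄ (Fintype.card F) = 1 ∨ ZMod.χ₄ (Fintype.card F) = -1 := by
    rcases (by omega : Fintype.card F % 4 = 1 ∨ Fintype.card F % 4 = 3) with h | h
    · exact Or.inl (ZMod.χ₄_nat_one_mod_four h)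
    · exact Or.inr (ZMod.χ₄_nat_three_mod_four h)
  have key := quadraticChar_zmod_five_ne_neg_one_iff
  have hmod : ∀ k : ℕ, Fintype.card F ≡ k [MOD 5] ↔ (Fintype.card F : ZMod 5) = (k : ZMod 5) :=
    fun k => (ZMod.natCast_eq_natCast_iff _ _ _).symm
  rw [hmod, hmod, hmod, Nat.cast_zero, Nat.cast_one, Nat.cast_ofNat]
  rcases hχ with h | h
  · rw [h, Int.cast_one, one_mul]
    exact (key _).1
  · rw [h, Int.cast_neg, Int.cast_one, neg_one_mul]
    exact (key _).2

end FiniteFieldSquares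

end IntersectionDensity

open IntersectionDensity

theorem theorem1p3 {V : Type*} [Finite V] (X : SimpleGraph V) [X.LocallyFinite]
    (hX : IntersectionDensity.IsCubicOfTypeOneTwo X)
    (p k q : ℕ) (hp : p.Prime) (hp2 : p ≠ 2) (hq : q = p ^ k)
    {F : Type*} [Field F] [Finite F] (hF : Nat.card F = q)
    (φ : PGL(2, F) ≃* (X ≃g X))
    (hG : IntersectionDensity.IsSArcRegular 1
      ((IntersectionDensity.pslSubgroup F).map φ.toMonoidHom)) :
    (p = 3 → Odd k → IntersectionDensity.weakDensityArray X = [3 ^ (k - 1)]) ∧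
    (p = 3 → Even k → IntersectionDensity.weakDensityArray X = [3 ^ (k / 2 - 1)]) ∧
    (q ≡ 1 [MOD 3] → p = 5 → IntersectionDensity.weakDensityArray X = [1, 2]) ∧
    (q ≡ 1 [MOD 3] → p ≠ 5 → IntersectionDensity.weakDensityArray X = [1, 4 / 3]) ∧
    (q ≡ 2 [MOD 3] → (q ≡ 2 [MOD 5] ∨ q ≡ 3 [MOD 5]) →
      IntersectionDensity.weakDensityArray X = [1]) ∧
    (q ≡ 2 [MOD 3] → (q ≡ 0 [MOD 5] ∨ q ≡ 1 [MOD 5] ∨ q ≡ 4 [MOD 5]) →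
      IntersectionDensity.weakDensityArray X = [1, 4 / 3]) := by
  have := Fintype.ofFinite F
  have hV := nonempty_of_mulEquiv φ
  have hpF : (p : F) = 0 := by
    have h := Nat.cast_card_eq_zero F
    rw [← Nat.card_eq_fintype_card, hF, hq, Nat.cast_pow] at h
    exact eq_zero_of_pow_eq_zero h
  have hchar : CharP F p := (CharP.charP_iff_prime_eq_zero hp).2 hpF
  have hcast : ∀ r : ℕ, r.Prime → p ≠ r → (r : F) ≠ 0 := by
    intro r hr hpr h
    rw [CharP.cast_eq_zero_iff F p, Nat.prime_dvd_prime_iff_eq hp hr] at h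
    exact hpr h
  have h2 : (2 : F) ≠ 0 := by exact_mod_cast hcast 2 Nat.prime_two hp2
  have hne3 : ¬ q ≡ 0 [MOD 3] → (3 : F) ≠ 0 := by
    intro hq3
    have hp3 : p ≠ 3 := by
      rintro rfl
      have hk : k ≠ 0 := by
        rintro rfl
        have := Finite.one_lt_card (α := F)
        rw [hF, hq] at this
        simp at this
      exact hq3 (Nat.modEq_zero_iff_dvd.2 (hq ▸ dvd_pow_self 3 hk))
    exact_mod_cast hcast 3 Nat.prime_three hp3
  have htop : (3 : F) ≠ 0 → IsMaxIntersecting (⊤ : Subgroup PGL(2, F)) 6 := fun h3 =>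
    IsMaxIntersecting.of_card_eq
      (exists_intersecting_of_card_eq hX φ hG (card_top_pgl hX φ hG))
      fun s _ hs => card_le_six_of_vertexFixing h2 h3 hs
  have hgoal : ∀ {n : ℕ} {l : List ℚ}, (3 : F) ≠ 0 → IsMaxIntersecting (pslSubgroup F) n →
      l.Pairwise (· < ·) → (∀ r, r ∈ l ↔ r = 1 ∨ r = n / 3) → weakDensityArray X = l := by
    intro n l h3 hn hl hr
    refine weakDensityArray_eq h2 hX φ hG (htop h3) hn hl ?_
    norm_num
    exact hr
  refine ⟨?_, ?_, ?_, ?_, ?_, ?_⟩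
  · rintro rfl hk
    have h3 : (3 : F) = 0 := by exact_mod_cast hpF
    have hsq := not_isSquare_neg_one h3 hX φ hG
    obtain ⟨j, rfl⟩ := hk
    refine weakDensityArray_eq h2 hX φ hG (m := 2 * Nat.card F) (n := Nat.card F)
      (IsMaxIntersecting.of_card_eq ?_ fun s _ hs => card_le_two_mul_card_field h3 hsq hs)
      (isMaxIntersecting_psl ?_ fun s hs => card_le_card_field h3 hsq hs)
      (List.pairwise_singleton _ _) fun r => ?_
    · obtain ⟨s, hs, hcard⟩ := exists_card_eq_two_mul_card_field h3 hsq
      exact ⟨s, fun f _ => Subgroup.mem_top f, hs, hcard.ge⟩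
    · obtain ⟨s, hsK, hs, hcard⟩ := exists_card_eq_card_field h3
      exact ⟨s, hsK, hs, hcard.ge⟩
    · rw [hF, hq]
      have h : ((3 ^ (2 * j + 1) : ℕ) : ℚ) / 3 = 3 ^ (2 * j) := by
        push_cast; rw [pow_succ]; field_simp
      have h' : ((2 * 3 ^ (2 * j + 1) : ℕ) : ℚ) / 6 = 3 ^ (2 * j) := by
        push_cast; rw [pow_succ]; field_simp; norm_num
      rw [h, h']
      simp
  · -- This case does not occur: the vertex stabilizers force `-1` to be a nonsquare.
    rintro rfl ⟨j, rfl⟩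
    have h3 : (3 : F) = 0 := by exact_mod_cast hpF
    refine absurd (FiniteField.isSquare_neg_one_iff.2 ?_) (not_isSquare_neg_one h3 hX φ hG)
    rw [← Nat.card_eq_fintype_card, hF, hq, ← two_mul, pow_mul, Nat.pow_mod]
    norm_num
  · rintro hq1 rfl
    have h3 := hne3 (by unfold Nat.ModEq at *; omega)
    have h5 : (5 : F) = 0 := by exact_mod_cast hpF
    obtain ⟨ω, hω⟩ := exists_cube_root (F := F) (hF ▸ hq1)
    obtain ⟨s, hsK, hs, hcard⟩ := exists_card_eq_six h5 h3 hω
    refine hgoal h3 (isMaxIntersecting_psl ⟨s, hsK, hs, hcard.ge⟩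
      fun s hs => card_le_six_of_pow_three h2 h3 hs) (by norm_num) fun r => ?_
    norm_num
  · intro hq1 hp5
    have h3 := hne3 (by unfold Nat.ModEq at *; omega)
    have h5 : (5 : F) ≠ 0 := by exact_mod_cast hcast 5 Nat.prime_five hp5
    obtain ⟨ω, hω⟩ := exists_cube_root (F := F) (hF ▸ hq1)
    obtain ⟨s, hsK, hs, hcard⟩ := exists_card_eq_four_of_cube_root h3 hω
    refine hgoal h3 (isMaxIntersecting_psl ⟨s, hsK, hs, hcard.ge⟩
      fun s hs => card_le_four_of_pow_three h2 h3 h5 hs) (by norm_num) fun r => ?_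
    norm_num
  · intro hq2 hq5
    have h3 := hne3 (by unfold Nat.ModEq at *; omega)
    have hsq3 := not_isSquare_neg_three h2 h3 (hF ▸ hq2)
    have hsq5 : ¬ IsSquare (5 : F) := by
      rw [isSquare_five_iff h2, hF]
      unfold Nat.ModEq at *
      omega
    refine hgoal h3 (isMaxIntersecting_psl
      (exists_intersecting_of_card_eq hX φ hG (card_pslSubgroup hX φ hG))
      fun s hs => card_le_three_of_pow_three h2 h3 hsq3 hsq5 hs) (by norm_num) fun r => ?_
    norm_num
  · intro hq2 hq5
    have h3 := hne3 (by unfold Nat.ModEq at *; omega)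
    have hsq3 := not_isSquare_neg_three h2 h3 (hF ▸ hq2)
    have hsq5 : IsSquare (5 : F) := by
      rw [isSquare_five_iff h2, hF]
      exact hq5
    obtain ⟨s, hsK, hs, hcard⟩ := exists_card_eq_four_of_isSquare_five h2 h3 hsq5
    refine hgoal h3 (isMaxIntersecting_psl ⟨s, hsK, hs, hcard.ge⟩
      fun s hs => card_le_four_of_not_isSquare h2 h3 hsq3 hs) (by norm_num) fun r => ?_
    norm_num
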